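/- **Setting.** Let $\mathcal A$ be a finite alphabet. A substitution is a map $\sigma$ from $\mathcal A$ to the set of non-empty finite words over $\mathcal A$, extended to words and to one- and two-sided sequences by concatenation. A directive sequence is a sequence $\boldsymbol\sigma=(\sigma_n)_{n\ge 0}$ of substitutions; put $\sigma_{[n,N)}=\sigma_n\circ\cdots\circ\sigma_{N-1}$. Let $X^{(n)}_{\boldsymbol\sigma}\subset\mathcal A^{\mathbb Z}$ be the set of two-sided sequences each of whose finite subwords is a subword of $\sigma_{[n,N)}(a)$ for some $a\in\mathcal A$ and $N>n$, let $\mathcal L^{(n)}_{\boldsymbol\sigma}$ be the set of finite words occurring in elements of $X^{(n)}_{\boldsymbol\sigma}$, and let $\tilde X^{(n)}_{\boldsymbol\sigma}\subset\mathcal A^{\mathbb N}$ be the set of one-sided sequences all of whose subwords lie in $\mathcal L^{(n)}_{\boldsymbol\sigma}$. Let $X_{\boldsymbol\sigma}=X^{(0)}_{\boldsymbol\sigma}$ and let $T$ be the left shift. - $\boldsymbol\sigma$ is *finitary* if $\{\sigma_n\}$ is contained in a finite set; *primitive* if for each $n$ there is $N>n$ such that every letter occurs in every $\sigma_{[n,N)}(a)$;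 of *constant length* with length sequence $(q_n)$ if $|\sigma_n(a)|=q_n$ for all $n$ and $a$. The substitution $\sigma_n$ has a *coincidence* if for some $i$ the $i$-th letter of $\sigma_n(a)$ does not depend on $a$. - A word is *essential* if it lies in $\mathcal L^{(n)}_{\boldsymbol\sigma}$ for infinitely many $n$, and *fully essential* if it does so for all $n$. - $\boldsymbol\sigma$ is *prefix-straight* if for each $a\in\mathcal A$ the words $\sigma_{[0,n_k)}(a)$ have exactly one right-infinite limit over all increasing sequences $(n_k)$ along which they converge. It is *straight* if for each essential two-letter word $ab$ there is exactly one two-sided limit word $\lim_k\sigma_{[0,n_k)}(a)\cdot\sigma_{[0,n_k)}(b)$, over all increasing sequences $(n_k)$ with $ab\in\mathcal L^{(n_k)}_{\boldsymbol\sigma}$ for every $k$ along which these words converge. - A centred $\sigma_n$-representation of $y$ is a pair $(k,x)$ with $y=T^k\sigma_n(x)$ and $0\le k<|\sigma_n(x_0)|$. $\boldsymbol\sigma$ is *recognizable* if for each $n$ every $y\in\mathcal A^{\mathbb Z}$ has at most one centred $\sigma_n$-representation with $x\in X^{(n+1)}_{\boldsymbol\sigma}$; it is *one-sided recognizable* if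 for each $n$ every $y\in\tilde X^{(n)}_{\boldsymbol\sigma}$ has a unique centred $\sigma_n$-representation with $x\in\tilde X^{(n+1)}_{\boldsymbol\sigma}$. - For a sequence $(r_n)_{n\ge0}$ of positive integers, $\mathbb Z_{(r_n)}$ is the compact group $\prod_{n\ge 0}\mathbb Z/r_n\mathbb Z$ with addition with carry, equivalently $\varprojlim_n\mathbb Z/(r_0\cdots r_{n-1})\mathbb Z$; if all $r_n\ge2$, then $(\mathbb Z_{(r_n)},+1)$ is called an *odometer*. $\mathbb Z_{\tilde h,(q_n)}$ is the group of the sequence $\tilde h,q_0,q_1,\dots$. - $(X_{\boldsymbol\sigma},T)$ is *Toeplitz* if there is a factor map $\pi$ from it onto an odometer such that $\{x:\pi^{-1}(\{\pi(x)\})=\{x\}\}$ is dense. The *maximal equicontinuous factor* is the equicontinuous factor through which every equicontinuous factor of $(X_{\boldsymbol\sigma},T)$ factors. For an invariant probability measure $\mu$, $(X_{\boldsymbol\sigma},T,\mu)$ has *discrete spectrum* if the eigenfunctions of $f\mapsto f\circ T$ span a dense subspace of $L^2(X_{\boldsymbol\sigma},\mu)$. - The *height* $\tilde h$ of $\boldsymbol\sigma$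 is the least common multiple of all integers $d\ge1$ that are coprime to every $q_n$ and such that some primitive $d$-th root of unity is a continuous eigenvalue of $(X_{\boldsymbol\sigma},T)$. **Theorem.** Let $\boldsymbol\sigma=(\sigma_n)_{n\ge0}$ be a finitary, primitive, constant-length directive sequence on $\mathcal A$, with length sequence $(q_n)_{n\ge0}$, $q_n\ge2$ for all $n$. Suppose that $\boldsymbol\sigma$ has a fully essential word of length $2$, and that $\sigma_n$ has a coincidence for infinitely many $n$. Suppose that either $\boldsymbol\sigma$ is prefix-straight and one-sided recognizable, or $\boldsymbol\sigma$ is straight and recognizable. Then 1. $(X_{\boldsymbol\sigma},T)$ is Toeplitz; 2. for every $T$-invariant Borel probability measure $\mu$ on $X_{\boldsymbol\sigma}$, the system $(X_{\boldsymbol\sigma},T,\mu)$ has discrete spectrum; 3. the height $\tilde h$ of $\boldsymbol\sigma$ is finite, and the maximal equicontinuous factor of $(X_{\boldsymbol\sigma},T)$ is $(\mathbb Z_{\tilde h,(q_n)},+1)$. -/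

import Mathlib

open MeasureTheory Filter Topology

universe u v

namespace SAdic

/-! ### Substitutions and directive sequences -/

section Combinatorics

variable {A : Type u}

/-- A substitution on the alphabet `A`: each letter has a non-empty finite word as its image. -/
@[ext]
structure Substitution (A : Type u) where
  toFun : A → List A
  ne_nil : ∀ a, toFun a ≠ []

instance : CoeFun (Substitution A) (fun _ => A → List A) := ⟨Substitution.toFun⟩

/-- The word `σ_{[n,n+m)}(a) = (σ_n ∘ σ_{n+1} ∘ ⋯ ∘ σ_{n+m-1})(a)`; for `m = 0` it is `a`. -/
def block (σ : ℕ → Substitution A) (n : ℕ) : ℕ → A → List A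
  | 0, a => [a]
  | m + 1, a => (σ (n + m) a).flatMap (block σ n m)

/-- The word `x_k x_{k+1} ⋯ x_{k+l-1}` of a two-sided sequence. -/
def word (x : ℤ → A) (k : ℤ) (l : ℕ) : List A :=
  List.ofFn (fun i : Fin l => x (k + (i : ℕ)))

/-- The word `x_k x_{k+1} ⋯ x_{k+l-1}` of a one-sided sequence. -/
def oneSidedWord (x : ℕ → A) (k l : ℕ) : List A :=
  List.ofFn (fun i : Fin l => x (k + i))

/-- The words that occur in some `σ_{[n,N)}(a)` with `N > n`. -/
def preLanguage (σ : ℕ → Substitution A) (n : ℕ) : Set (List A) :=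
  {w | ∃ m, 0 < m ∧ ∃ a, w <:+: block σ n m a}

/-- The two-sided shift `X_σ^{(n)}` of level `n`. -/
def shiftSpace (σ : ℕ → Substitution A) (n : ℕ) : Set (ℤ → A) :=
  {x | ∀ k l, word x k l ∈ preLanguage σ n}

/-- The language `L_σ^{(n)}` of the two-sided shift of level `n`. -/
def language (σ : ℕ → Substitution A) (n : ℕ) : Set (List A) :=
  {w | ∃ x ∈ shiftSpace σ n, ∃ k l, w = word x k l}

/-- The one-sided shift of level `n`: all words of the sequence lie in `L_σ^{(n)}`. -/
def oneSidedShiftSpace (σ : ℕ → Substitution A) (n : ℕ) : Set (ℕ → A) :=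
  {x | ∀ k l, oneSidedWord x k l ∈ language σ n}

/-- All substitutions of the sequence lie in one finite set. -/
def Finitary (σ : ℕ → Substitution A) : Prop :=
  ∃ S : Set (Substitution A), S.Finite ∧ ∀ n, σ n ∈ S

/-- `σ_n` maps every letter to a word of length `q n`. -/
def ConstantLength (σ : ℕ → Substitution A) (q : ℕ → ℕ) : Prop :=
  ∀ n a, (σ n a).length = q n

open Classical in
/-- The incidence matrix of `τ`: the entry `(a, b)` counts the occurrences of `a` in `τ b`. -/
noncomputable def incidenceMatrix (τ : A → List A) : Matrix A A ℕ :=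
  Matrix.of fun a b => (τ b).count a

/-- For each `n` some `σ_{[n,N)}`, `N > n`, has a positive incidence matrix. -/
def Primitive (σ : ℕ → Substitution A) : Prop :=
  ∀ n, ∃ m, 0 < m ∧ ∀ a b, 0 < incidenceMatrix (block σ n m) a b

def Essential (σ : ℕ → Substitution A) (w : List A) : Prop :=
  {n | w ∈ language σ n}.Infinite

def FullyEssential (σ : ℕ → Substitution A) (w : List A) : Prop :=
  Essential σ w ∧ ∀ n, w ∈ language σ n

/-- Some column of the substitution takes a single value on all letters. -/
def HasCoincidence (τ : Substitution A) : Prop :=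
  ∃ (i : ℕ) (c : A), ∀ a, (τ a)[i]? = some c

/-! ### Limit words and straightness -/

/-- The finite words `w k` converge to the right-infinite sequence `u`. -/
def WordsTendsto (w : ℕ → List A) (u : ℕ → A) : Prop :=
  ∀ i, ∀ᶠ k in atTop, (w k)[i]? = some (u i)

/-- The right-infinite limits of `σ_{[0,n_k)}(a)` along increasing sequences `(n_k)`. -/
def oneSidedLimitWords (σ : ℕ → Substitution A) (a : A) : Set (ℕ → A) :=
  {u | ∃ s : ℕ → ℕ, StrictMono s ∧ WordsTendsto (fun k => block σ 0 (s k) a) u}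

/-- The two-sided limit words `lim σ_{[0,n_k)}(a) · σ_{[0,n_k)}(b)`, along increasing sequences
`(n_k)` such that `ab` lies in the language of level `n_k` for every `k`. -/
def limitWords (σ : ℕ → Substitution A) (a b : A) : Set (ℤ → A) :=
  {u | ∃ s : ℕ → ℕ, StrictMono s ∧ (∀ k, [a, b] ∈ language σ (s k)) ∧
    WordsTendsto (fun k => (block σ 0 (s k) a).reverse) (fun i => u (-1 - (i : ℤ))) ∧
    WordsTendsto (fun k => block σ 0 (s k) b) (fun i => u (i : ℤ))}

def PrefixStraight (σ : ℕ → Substitution A) : Prop :=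
  ∀ a, ∃ u, oneSidedLimitWords σ a = {u}

def Straight (σ : ℕ → Substitution A) : Prop :=
  ∀ a b, Essential σ [a, b] → ∃ u, limitWords σ a b = {u}

/-! ### Recognizability -/

/-- `z = τ(x)` for two-sided sequences: the word `τ(x_n)` occupies the positions of `z` from
`p n` up to `p (n + 1) - 1`, and `τ(x_0)` starts at position `0`. -/
def IsImage (τ : Substitution A) (x z : ℤ → A) : Prop :=
  ∃ p : ℤ → ℤ, p 0 = 0 ∧ (∀ n, p (n + 1) = p n + ((τ (x n)).length : ℤ)) ∧
    ∀ n (j : ℕ) (hj : j < (τ (x n)).length), z (p n + j) = (τ (x n))[j]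

/-- `z = τ(x)` for one-sided sequences. -/
def IsOneSidedImage (τ : Substitution A) (x z : ℕ → A) : Prop :=
  ∃ p : ℕ → ℕ, p 0 = 0 ∧ (∀ n, p (n + 1) = p n + (τ (x n)).length) ∧
    ∀ n (j : ℕ) (hj : j < (τ (x n)).length), z (p n + j) = (τ (x n))[j]

/-- `(k, x)` is a centred `τ`-representation of `y`: `y = T^k τ(x)` and `0 ≤ k < |τ(x_0)|`. -/
def IsRepresentation (τ : Substitution A) (y : ℤ → A) (r : ℕ × (ℤ → A)) : Prop :=
  r.1 < (τ (r.2 0)).length ∧ ∃ z, IsImage τ r.2 z ∧ ∀ i, y i = z (i + r.1)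

def IsOneSidedRepresentation (τ : Substitution A) (y : ℕ → A) (r : ℕ × (ℕ → A)) : Prop :=
  r.1 < (τ (r.2 0)).length ∧ ∃ z, IsOneSidedImage τ r.2 z ∧ ∀ i, y i = z (i + r.1)

/-- At each level `n`, a two-sided sequence has at most one centred `σ_n`-representation in
`X_σ^{(n+1)}`. -/
def Recognizable (σ : ℕ → Substitution A) : Prop :=
  ∀ n (y : ℤ → A) (r r' : ℕ × (ℤ → A)),
    r.2 ∈ shiftSpace σ (n + 1) → r'.2 ∈ shiftSpace σ (n + 1) →
    IsRepresentation (σ n) y r → IsRepresentation (σ n) y r' → r = r'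

/-- At each level `n`, every point of the one-sided shift of level `n` has a unique centred
`σ_n`-representation in the one-sided shift of level `n + 1`. -/
def OneSidedRecognizable (σ : ℕ → Substitution A) : Prop :=
  ∀ n, ∀ y ∈ oneSidedShiftSpace σ n,
    ∃! r : ℕ × (ℕ → A), r.2 ∈ oneSidedShiftSpace σ (n + 1) ∧ IsOneSidedRepresentation (σ n) y r

/-! ### The `S`-adic dynamical system -/

/-- The `S`-adic shift `X_σ = X_σ^{(0)}` as a space. -/
abbrev Shift (σ : ℕ → Substitution A) : Type u := shiftSpace σ 0

theorem word_shift (x : ℤ → A) (k : ℤ) (l : ℕ) :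
    word (fun i => x (i + 1)) k l = word x (k + 1) l := by
  simp only [word, add_right_comm]

/-- The left shift `T` on `X_σ`. -/
def shiftMap (σ : ℕ → Substitution A) (x : Shift σ) : Shift σ :=
  ⟨fun i => x.1 (i + 1), fun k l => by rw [word_shift]; exact x.2 (k + 1) l⟩

end Combinatorics

/-! ### Odometers -/

/-- The odometer group `ℤ_{(r_n)}`, as the inverse limit of the groups `ℤ/(r_0 ⋯ r_{n-1})ℤ`. The
digit sequence `(z_n)`, `0 ≤ z_n < r_n`, with addition with carry, corresponds to the sequence of
residues of `z_0 + z_1 r_0 + ⋯ + z_{n-1} r_0 ⋯ r_{n-2}` modulo `r_0 ⋯ r_{n-1}`. -/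
def Odometer (r : ℕ → ℕ) : AddSubgroup (∀ n, ZMod (∏ i ∈ Finset.range n, r i)) where
  carrier := {x | ∀ n,
    ZMod.castHom (Dvd.intro (r n) (Finset.prod_range_succ r n).symm)
      (ZMod (∏ i ∈ Finset.range n, r i)) (x (n + 1)) = x n}
  zero_mem' := fun n => map_zero _
  add_mem' := fun {x y} hx hy n => by
    rw [Pi.add_apply, map_add, hx n, hy n, Pi.add_apply]
  neg_mem' := fun {x} hx n => by
    rw [Pi.neg_apply, map_neg, hx n, Pi.neg_apply]

/-- The unit of the odometer group. -/
def Odometer.unit (r : ℕ → ℕ) : Odometer r := ⟨fun _ => 1, fun _ => map_one _⟩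

/-- The homeomorphism `+1` of the odometer. -/
def Odometer.addOne (r : ℕ → ℕ) : Odometer r ≃ₜ Odometer r :=
  Homeomorph.addRight (Odometer.unit r)

/-- The sequence `h, q_0, q_1, q_2, …`. -/
def consSeq (h : ℕ) (q : ℕ → ℕ) : ℕ → ℕ
  | 0 => h
  | n + 1 => q n

/-! ### Topological and measurable dynamics -/

/-- A factor map from `(X, T)` to `(Z, S)`. -/
structure IsFactorMap {X : Type u} {Z : Type v} [TopologicalSpace X] [TopologicalSpace Z]
    (T : X → X) (S : Z → Z) (π : X → Z) : Prop where
  continuous : Continuous π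
  surjective : Function.Surjective π
  semiconj : Function.Semiconj π T S

/-- `(Z, S)` is an equicontinuous system: `Z` is compact Hausdorff and the family
`{S^n : n ∈ ℤ}` is equicontinuous for the (unique) uniformity of `Z`. -/
structure IsEquicontinuousSystem {Z : Type v} [t : TopologicalSpace Z] (S : Z ≃ₜ Z) : Prop where
  compact : CompactSpace Z
  hausdorff : T2Space Z
  equicontinuous : ∃ U : UniformSpace Z, U.toTopologicalSpace = t ∧
    @Equicontinuous ℤ Z Z t U (fun n => ⇑(S ^ n))

/-- `(Z, S)` is an equicontinuous factor of `(X, T)` through which every equicontinuous factor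
of `(X, T)` factors. -/
def IsMaximalEquicontinuousFactor.{a, b, c} {X : Type a} {Z : Type b} [TopologicalSpace X]
    [TopologicalSpace Z] (T : X → X) (S : Z ≃ₜ Z) : Prop :=
  IsEquicontinuousSystem S ∧ ∃ π : X → Z, IsFactorMap T S π ∧
    ∀ (Y : Type c) [TopologicalSpace Y] (R : Y ≃ₜ Y), IsEquicontinuousSystem R →
      ∀ φ : X → Y, IsFactorMap T R φ → ∃ ψ : Z → Y, IsFactorMap S R ψ ∧ φ = ψ ∘ π

/-- `(X, T)` is an almost one-to-one extension of an odometer. -/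
def IsToeplitz {X : Type u} [TopologicalSpace X] (T : X → X) : Prop :=
  ∃ r : ℕ → ℕ, (∀ n, 2 ≤ r n) ∧ ∃ π : X → Odometer r,
    IsFactorMap T (Odometer.addOne r) π ∧ Dense {x | π ⁻¹' {π x} = {x}}

/-- `(X, T, μ)` has discrete spectrum: the eigenfunctions of `f ↦ f ∘ T` span a dense subspace
of `L²(X, μ)`. -/
def HasDiscreteSpectrum {X : Type u} [MeasurableSpace X] {T : X → X} {μ : Measure X}
    (hT : MeasurePreserving T μ μ) : Prop :=
  (⨆ l : ℂ, Module.End.eigenspace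
    (Lp.compMeasurePreservingₗᵢ (E := ℂ) (p := 2) ℂ T hT).toLinearMap l).topologicalClosure = ⊤

/-- `l` is a continuous eigenvalue of `(X, T)`. -/
def IsContinuousEigenvalue {X : Type u} [TopologicalSpace X] (T : X → X) (l : ℂ) : Prop :=
  ∃ f : X → ℂ, Continuous f ∧ f ≠ 0 ∧ ∀ x, f (T x) = l * f x

/-! ### Height -/

/-- The orders, coprime to every `q n`, of the roots of unity that are continuous eigenvalues
of `(X, T)`. -/
def coprimeOrders {X : Type u} [TopologicalSpace X] (T : X → X) (q : ℕ → ℕ) : Set ℕ :=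
  {d | 0 < d ∧ (∀ n, d.Coprime (q n)) ∧ ∃ l : ℂ, IsPrimitiveRoot l d ∧ IsContinuousEigenvalue T l}

/-- The least common multiple of the coprime orders (and `0` if they have no common multiple). -/
noncomputable def height {X : Type u} [TopologicalSpace X] (T : X → X) (q : ℕ → ℕ) : ℕ :=
  sInf {m | 0 < m ∧ ∀ d ∈ coprimeOrders T q, d ∣ m}

end SAdic

universe w

namespace SAdic

/-! ### Words and images of two-sided sequences -/

section Words

variable {A : Type u} {σ : ℕ → Substitution A} {q : ℕ → ℕ}

/-! Either form of recognizability makes desubstitution unique, so a point `y` of the shift can be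
written as `T^k σ_{[0,n)}(x)` with `k` determined modulo `P_n = q_0 ⋯ q_{n-1}`. This residue is
continuous and increases by `1` under the shift, and the residues for all `n` assemble to a factor
map onto the odometer of `(q_n)`.

Coincidences control the fibres. If coordinate `j` of `y` falls, at level `m`, in a column where
`σ_m` has a coincidence, then the residue modulo `P_{m+1}` alone determines `y_j`
(`eq_of_mem_hitSet`). These coordinates form intervals of length at least `P_m`, for infinitely many
`m`. Four consequences follow.

Toeplitz: for each `j`, the points whose `j`-th coordinate is so determined form a dense open set by
bounded gaps, and Baire applies.

Discrete spectrum: the undetermined points form a null set, since a coincidence level removes at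
least the fraction `1/q_n` of what is left and `q_n` is bounded (`measure_iInter_hitSet_compl`).
Hence residues generate the σ-algebra modulo null sets, and functions of a residue are combinations
of characters.

Maximality: points with equal residues agree on arbitrarily long windows after shifting, so
equicontinuous factors identify them (`apply_eq_of_residue_eq`).

Height: the same argument for `y` and `T^{P_n} y` forces an eigenvalue of order coprime to all `q_n`
to be `1`, so the height is `1`. -/

/-- The translate `T^d x`. -/
def translate (d : ℤ) (x : ℤ → A) : ℤ → A := fun i => x (i + d)

/-- The image `τ(x)` of a two-sided sequence under a substitution of constant length `l`. -/
def image (τ : Substitution A) (l : ℕ) (x : ℤ → A) : ℤ → A :=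
  fun t => (τ (x (t / l))).getD (t % l).toNat (x (t / l))

/-- The image of a two-sided sequence under `σ_0 ∘ ⋯ ∘ σ_{n-1}`. -/
def imageIter (σ : ℕ → Substitution A) (q : ℕ → ℕ) : ℕ → (ℤ → A) → ℤ → A
  | 0, x => x
  | n + 1, x => imageIter σ q n (image (σ n) (q n) x)

/-- The length `q_0 ⋯ q_{n-1}` of the words `σ_{[0,n)}(a)`. -/
abbrev prodLen (q : ℕ → ℕ) (n : ℕ) : ℕ := ∏ i ∈ Finset.range n, q i

theorem prodLen_succ (q : ℕ → ℕ) (n : ℕ) : prodLen q (n + 1) = prodLen q n * q n :=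
  Finset.prod_range_succ q n

theorem prodLen_pos (hq : ∀ n, 2 ≤ q n) (n : ℕ) : 0 < prodLen q n :=
  Finset.prod_pos fun i _ => by have := hq i; omega

theorem lt_prodLen (hq : ∀ n, 2 ≤ q n) (n : ℕ) : n < prodLen q n := by
  induction n with
  | zero => simp
  | succ n ih => rw [prodLen_succ]; nlinarith [hq n]

theorem prodLen_dvd (q : ℕ → ℕ) {m n : ℕ} (h : m ≤ n) : prodLen q m ∣ prodLen q n :=
  Finset.prod_dvd_prod_of_subset _ _ _ (Finset.range_subset_range.2 h)

theorem translate_translate (d e : ℤ) (x : ℤ → A) :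
    translate d (translate e x) = translate (d + e) x := by
  funext i; simp [translate, add_assoc]

theorem translate_zero (x : ℤ → A) : translate 0 x = x := by
  funext i; simp [translate]

theorem translate_neg_eq {d : ℤ} {x y : ℤ → A} (h : y = translate d x) : x = translate (-d) y := by
  rw [h, translate_translate]; simp [translate_zero]

theorem word_translate (d : ℤ) (x : ℤ → A) (k : ℤ) (l : ℕ) :
    word (translate d x) k l = word x (k + d) l := by
  simp only [word, translate, add_right_comm]

theorem translate_mem {n : ℕ} {x : ℤ → A} (hx : x ∈ shiftSpace σ n) (d : ℤ) :
    translate d x ∈ shiftSpace σ n := fun k l => by rw [word_translate]; exact hx _ _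

@[simp] theorem length_word (x : ℤ → A) (k : ℤ) (l : ℕ) : (word x k l).length = l := by
  simp [word]

@[simp] theorem getElem_word (x : ℤ → A) (k : ℤ) (l i : ℕ) (h : i < (word x k l).length) :
    (word x k l)[i] = x (k + i) := by
  simp [word]

theorem word_add (x : ℤ → A) (k : ℤ) (a b : ℕ) :
    word x k (a + b) = word x k a ++ word x (k + a) b := by
  apply List.ext_getElem (by simp)
  intro i h1 h2
  simp only [getElem_word, List.getElem_append, length_word]
  split_ifs with h
  · rfl
  · congr 1
    push_cast [not_lt.1 h]
    ring

theorem word_infix (x : ℤ → A) {k k' : ℤ} {l l' : ℕ} (h1 : k' ≤ k) (h2 : k + l ≤ k' + l') :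
    word x k l <:+: word x k' l' := by
  obtain ⟨a, ha⟩ := Int.eq_ofNat_of_zero_le (sub_nonneg.2 h1)
  obtain ⟨b, hb⟩ := Int.eq_ofNat_of_zero_le (sub_nonneg.2 h2)
  have hl : l' = a + l + b := by omega
  refine ⟨word x k' a, word x (k + l) b, ?_⟩
  rw [hl, word_add, word_add]
  have e1 : k' + (a : ℤ) = k := by omega
  have e2 : k' + ((a + l : ℕ) : ℤ) = k + l := by push_cast; omega
  rw [e1, e2]

theorem image_translate (τ : Substitution A) {l : ℕ} (hl : 0 < l) (e : ℤ) (x : ℤ → A) :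
    image τ l (translate e x) = translate (l * e) (image τ l x) := by
  have hl' : (l : ℤ) ≠ 0 := by omega
  funext t
  simp only [image, translate, Int.add_mul_ediv_left _ _ hl', Int.add_mul_emod_self_left]

theorem imageIter_translate (hq : ∀ n, 2 ≤ q n) (n : ℕ) (e : ℤ) (x : ℤ → A) :
    imageIter σ q n (translate e x) = translate (prodLen q n * e) (imageIter σ q n x) := by
  induction n generalizing e x with
  | zero => simp [imageIter]
  | succ n ih =>
    rw [imageIter, image_translate _ (by have := hq n; omega), ih, imageIter, prodLen_succ,
      Nat.cast_mul, mul_assoc]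

/-- Nested floor divisions by the `q_i` combine into one division by their product, so position `t`
lies in the block of a single level-`n` letter. -/
theorem imageIter_congr (n : ℕ) {x x' : ℤ → A} {t : ℤ}
    (h : x (t / prodLen q n) = x' (t / prodLen q n)) :
    imageIter σ q n x t = imageIter σ q n x' t := by
  induction n generalizing x x' with
  | zero => simpa [imageIter] using h
  | succ n ih =>
    refine ih ?_
    have : t / (prodLen q n : ℤ) / (q n : ℤ) = t / (prodLen q (n + 1) : ℕ) := by
      rw [prodLen_succ, Nat.cast_mul, Int.ediv_ediv_of_nonneg (by positivity)]
    simp only [image, this, h]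

theorem word_image_single (τ : Substitution A) {l : ℕ} (hl : ∀ a, (τ a).length = l)
    (x : ℤ → A) (s : ℤ) : word (image τ l x) (l * s) l = τ (x s) := by
  apply List.ext_getElem (by simp [hl])
  intro i h1 h2
  have hi : (i : ℤ) < l := by simpa using h1
  have e1 : ((l : ℤ) * s + i) / l = s := by
    rw [add_comm, Int.add_mul_ediv_left _ _ (by omega), Int.ediv_eq_zero_of_lt (by omega) hi,
      zero_add]
  have e2 : ((l : ℤ) * s + i) % l = i := by
    rw [add_comm, Int.add_mul_emod_self_left, Int.emod_eq_of_lt (by omega) hi]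
  simp only [getElem_word, image, e1, e2, Int.toNat_natCast]
  simp [h2]

theorem word_one (x : ℤ → A) (s : ℤ) : word x s 1 = [x s] := by simp [word]

theorem word_image (τ : Substitution A) {l : ℕ} (hl : ∀ a, (τ a).length = l)
    (x : ℤ → A) (t : ℤ) (m : ℕ) :
    word (image τ l x) (l * t) (l * m) = (word x t m).flatMap τ := by
  induction m with
  | zero => simp [word]
  | succ m ih =>
    rw [mul_add, mul_one, word_add, ih, word_add x t m 1, List.flatMap_append, word_one,
      List.flatMap_singleton, Nat.cast_mul, ← mul_add, word_image_single τ hl]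

theorem word_imageIter (hlen : ConstantLength σ q) (n : ℕ) (x : ℤ → A) (t : ℤ) (m : ℕ) :
    word (imageIter σ q n x) (prodLen q n * t) (prodLen q n * m) =
      (word x t m).flatMap (block σ 0 n) := by
  induction n generalizing x t m with
  | zero =>
    simp only [imageIter, prodLen, Finset.range_zero, Finset.prod_empty, Nat.cast_one, one_mul]
    exact (List.flatMap_singleton' _).symm
  | succ n ih =>
    have := ih (image (σ n) (q n) x) (q n * t) (q n * m)
    rw [word_image (σ n) (hlen n), List.flatMap_assoc, ← mul_assoc, ← mul_assoc, ← Nat.cast_mul,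
      ← prodLen_succ] at this
    simpa [imageIter, block] using this

theorem block_add (σ : ℕ → Substitution A) (n m m' : ℕ) (a : A) :
    block σ n (m + m') a = (block σ (n + m) m' a).flatMap (block σ n m) := by
  induction m' generalizing a with
  | zero => simp [block]
  | succ m' ih =>
    rw [← add_assoc, block, block, List.flatMap_assoc, ← add_assoc]
    congr 1
    funext b
    exact ih b

theorem block_one_add (σ : ℕ → Substitution A) (n m : ℕ) (a : A) :
    block σ n (m + 1) a = (block σ (n + 1) m a).flatMap (σ n) := by
  rw [add_comm, block_add]
  congr 1
  funext b
  simp [block]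

theorem preLanguage_of_infix {n : ℕ} {w w' : List A} (h : w <:+: w')
    (hw : w' ∈ preLanguage σ n) : w ∈ preLanguage σ n := by
  obtain ⟨m, hm, a, ha⟩ := hw
  exact ⟨m, hm, a, h.trans ha⟩

theorem flatMap_mem_preLanguage {n : ℕ} {w : List A} (hw : w ∈ preLanguage σ (n + 1)) :
    w.flatMap (σ n) ∈ preLanguage σ n := by
  obtain ⟨m, hm, a, ha⟩ := hw
  exact ⟨m + 1, by omega, a, by rw [block_one_add]; exact ha.flatMap _⟩

theorem image_mem (hlen : ConstantLength σ q) (hq : ∀ n, 2 ≤ q n) {n : ℕ} {x : ℤ → A}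
    (hx : x ∈ shiftSpace σ (n + 1)) : image (σ n) (q n) x ∈ shiftSpace σ n := by
  intro k l
  have hq0 : (0 : ℤ) < q n := by have := hq n; omega
  -- One letter more than `l` absorbs the misalignment of `k` with the block boundaries.
  refine preLanguage_of_infix ?_ (flatMap_mem_preLanguage (hx (k / q n) (l + 1)))
  rw [← word_image (σ n) (hlen n)]
  refine word_infix _ (Int.mul_ediv_self_le hq0.ne') ?_
  have h1 := Int.lt_mul_ediv_self_add (x := k) hq0
  have h2 : (l : ℤ) ≤ q n * l := by nlinarith
  push_cast
  linarith

/-- Under primitivity, every word of the level-`0` language occurs in all words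
`σ_{[0,n)}(b)` for some `n`. -/
theorem exists_forall_infix_block (hprim : Primitive σ) {w : List A}
    (hw : w ∈ preLanguage σ 0) : ∃ n, ∀ b, w <:+: block σ 0 n b := by
  obtain ⟨m, -, a, ha⟩ := hw
  obtain ⟨m', -, h⟩ := hprim m
  refine ⟨m + m', fun b => ha.trans ?_⟩
  rw [block_add, zero_add]
  have hab : a ∈ block σ m m' b := by
    classical
    have := h a b
    simp only [incidenceMatrix, Matrix.of_apply] at this
    exact List.count_pos_iff.1 this
  obtain ⟨s, t, e⟩ := List.append_of_mem hab
  rw [e]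
  exact ⟨s.flatMap (block σ 0 m), t.flatMap (block σ 0 m), by simp⟩

end Words

/-! ### Recognizability -/

section Recognizability

variable {A : Type u} {σ : ℕ → Substitution A} {q : ℕ → ℕ}

/-- For points of the level-`(n+1)` shifts, `σ_n(x') = T^d σ_n(x)` with `0 ≤ d < q_n` only in the
trivial case. -/
def UniqueDesubstitution (σ : ℕ → Substitution A) (q : ℕ → ℕ) : Prop :=
  ∀ (n d : ℕ) (x x' : ℤ → A), x ∈ shiftSpace σ (n + 1) → x' ∈ shiftSpace σ (n + 1) → d < q n →
    image (σ n) (q n) x' = translate d (image (σ n) (q n) x) → d = 0 ∧ x' = x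

theorem image_apply (τ : Substitution A) {l : ℕ} (hl : ∀ a, (τ a).length = l) (x : ℤ → A) (n : ℤ)
    (j : ℕ) (hj : j < (τ (x n)).length) : image τ l x (l * n + j) = (τ (x n))[j] := by
  have h := word_image_single τ hl x n
  have hj' : j < (word (image τ l x) (l * n) l).length := by simpa [hl] using hj
  have := getElem_word (image τ l x) (l * n) l j hj'
  rw [← this]
  simp only [h]

theorem isImage_image (τ : Substitution A) {l : ℕ} (hl : ∀ a, (τ a).length = l) (x : ℤ → A) :
    IsImage τ x (image τ l x) :=
  ⟨fun n => l * n, by simp, fun n => by simp [hl]; ring, fun n j hj => image_apply τ hl x n j hj⟩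

theorem isOneSidedImage_image (τ : Substitution A) {l : ℕ} (hl : ∀ a, (τ a).length = l)
    (x : ℤ → A) : IsOneSidedImage τ (fun i => x i) (fun i => image τ l x i) :=
  ⟨fun n => l * n, by simp, fun n => by simp [hl]; ring, fun n j hj => by
    have := image_apply τ hl x n j hj
    push_cast at this ⊢
    exact this⟩

/-- The pairs `(d, x)` and `(0, x')` are both centred representations of `σ_n(x')`. -/
theorem Recognizable.uniqueDesubstitution (h : Recognizable σ) (hlen : ConstantLength σ q) :
    UniqueDesubstitution σ q := by
  intro n d x x' hx hx' hd e
  have h0 : 0 < q n := by omega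
  have := h n (image (σ n) (q n) x') (d, x) (0, x') hx hx'
    ⟨by simpa [hlen n] using hd, _, isImage_image (σ n) (hlen n) x, fun i => by rw [e]; rfl⟩
    ⟨by simpa [hlen n] using h0, _, isImage_image (σ n) (hlen n) x', fun i => by simp⟩
  simp only [Prod.mk.injEq] at this
  exact ⟨this.1, this.2.symm⟩

theorem restrict_mem {n : ℕ} {x : ℤ → A} (hx : x ∈ shiftSpace σ n) :
    (fun i : ℕ => x i) ∈ oneSidedShiftSpace σ n := fun k l =>
  ⟨x, hx, k, l, by simp [word, oneSidedWord]⟩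

/-- One-sided uniqueness sees only right halves, but the hypothesis is invariant under translating
`x` and `x'` together, and the right halves of all translates reach every coordinate. -/
theorem OneSidedRecognizable.uniqueDesubstitution (h : OneSidedRecognizable σ)
    (hlen : ConstantLength σ q) (hq : ∀ n, 2 ≤ q n) : UniqueDesubstitution σ q := by
  intro n d x x' hx hx' hd e
  have h0 : 0 < q n := by omega
  have key : ∀ m : ℤ, d = 0 ∧ ∀ i : ℕ, x' (i + m) = x (i + m) := by
    intro m
    have hm := translate_mem hx m
    have hm' := translate_mem hx' m
    have e' : image (σ n) (q n) (translate m x') =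
        translate d (image (σ n) (q n) (translate m x)) := by
      rw [image_translate _ h0, image_translate _ h0, e, translate_translate,
        translate_translate, add_comm]
    have := (h n _ (restrict_mem (image_mem hlen hq hm'))).unique
      (y₁ := (d, fun i => translate m x i)) (y₂ := (0, fun i => translate m x' i))
      ⟨restrict_mem hm, by simpa [hlen n] using hd, _,
        isOneSidedImage_image (σ n) (hlen n) (translate m x), fun i => by
          rw [e']; simp [translate]⟩
      ⟨restrict_mem hm', by simpa [hlen n] using h0, _,
        isOneSidedImage_image (σ n) (hlen n) (translate m x'), fun i => by simp⟩
    simp only [Prod.mk.injEq] at this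
    exact ⟨this.1, fun i => (congrFun this.2 i).symm⟩
  refine ⟨(key 0).1, funext fun i => ?_⟩
  simpa using (key i).2 0

/-- Induction on the level: the displacement `d` found at level `n` splits as remainder plus `q_n`
times quotient. Unique desubstitution kills the remainder, and the quotient is the displacement at
level `n + 1`. -/
theorem UniqueDesubstitution.iterate (h : UniqueDesubstitution σ q) (hlen : ConstantLength σ q)
    (hq : ∀ n, 2 ≤ q n) (n : ℕ) {k k' : ℤ} {x x' : ℤ → A} (hx : x ∈ shiftSpace σ n)
    (hx' : x' ∈ shiftSpace σ n)
    (e : translate k (imageIter σ q n x) = translate k' (imageIter σ q n x')) :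
    ∃ d : ℤ, k = k' + prodLen q n * d ∧ x' = translate d x := by
  induction n generalizing x x' with
  | zero =>
    refine ⟨k - k', by simp, ?_⟩
    have := translate_neg_eq e
    simp only [imageIter, translate_translate] at this
    rw [this, sub_eq_neg_add]
  | succ n ih =>
    obtain ⟨d, hd, e'⟩ := ih (image_mem hlen hq hx) (image_mem hlen hq hx') e
    have h0 : (0 : ℤ) < q n := by have := hq n; omega
    have hr := Int.emod_nonneg d h0.ne'
    have hr' := Int.emod_lt_of_pos d h0
    obtain ⟨r, hr0⟩ := Int.eq_ofNat_of_zero_le hr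
    have e2 : image (σ n) (q n) x' =
        translate r (image (σ n) (q n) (translate (d / q n) x)) := by
      rw [image_translate _ (by omega), translate_translate, e', ← hr0, Int.emod_add_mul_ediv]
    obtain ⟨r0, e3⟩ := h n r _ x' (translate_mem hx _) hx' (by omega) e2
    refine ⟨d / q n, ?_, e3⟩
    have := Int.emod_add_mul_ediv d (q n)
    rw [hr0, r0] at this
    rw [prodLen_succ, hd, Nat.cast_mul, mul_assoc]
    simp only [Nat.cast_zero, zero_add] at this
    rw [this]

theorem exists_desubstitution_window (hlen : ConstantLength σ q) (hq : ∀ n, 2 ≤ q n) {n : ℕ}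
    {y : ℤ → A} (hy : y ∈ shiftSpace σ n) (N : ℕ) :
    ∃ (d : Fin (q n)) (x : ℤ → A), word x (-N) (2 * N + 1) ∈ preLanguage σ (n + 1) ∧
      ∀ i : ℤ, |i| ≤ N → y i = image (σ n) (q n) x (i + (d : ℕ)) := by
  have h2 := hq n
  set M : ℕ := q n * (N + 1) with hM
  obtain ⟨m, hm, a, w₁, w₃, hw⟩ := hy (-M) (2 * M)
  have hMq : q n ≤ M := by rw [hM]; nlinarith
  -- The window is too long for a single `σ_n`-block, so a letter of level `n + 1` has been
  -- substituted at least once more and `u` below is in `preLanguage σ (n + 1)`.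
  have hm2 : m ≠ 1 := by
    rintro rfl
    have := congrArg List.length hw
    simp [block, hlen n] at this
    omega
  obtain ⟨m, rfl⟩ : ∃ m', m = m' + 1 := ⟨m - 1, by omega⟩
  rw [block_one_add] at hw
  set u := block σ (n + 1) m a
  have hu : u ∈ preLanguage σ (n + 1) := ⟨m, by omega, a, List.infix_refl _⟩
  let x₀ : ℤ → A := fun t => u.getD t.toNat a
  have hx₀ : word x₀ 0 u.length = u := by
    apply List.ext_getElem (by simp)
    intro i _ h
    simp [x₀, h]
  have him := word_image (σ n) (hlen n) x₀ 0 u.length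
  rw [hx₀, ← hw, mul_zero] at him
  have hlenEq := congrArg List.length him
  simp only [length_word, List.length_append] at hlenEq
  have hval : ∀ j : ℤ, -M ≤ j → j < M →
      y j = image (σ n) (q n) x₀ (j + (M + w₁.length : ℕ)) := by
    intro j hj1 hj2
    obtain ⟨i, hi⟩ := Int.eq_ofNat_of_zero_le (show 0 ≤ j + M by omega)
    have hi' : i < 2 * M := by omega
    have e1 : (word y (-M) (2 * M))[i]'(by simpa using hi') = y j := by
      rw [getElem_word]; congr 1; omega
    have e2 : (word (image (σ n) (q n) x₀) 0 (q n * u.length))[w₁.length + i]'(by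
        simp; omega) = (word y (-M) (2 * M))[i]'(by simpa using hi') := by
      simp only [him]
      rw [List.getElem_append_left (by simp; omega), List.getElem_append_right (by simp)]
      simp
    rw [← e1, ← e2, getElem_word]
    congr 1
    push_cast
    omega
  -- `s` is the place of coordinate `0` of `y` inside `σ_n(u)`. Its remainder modulo `q_n` becomes
  -- the offset and its quotient the origin of `x`; `he1` and `he2` leave enough letters of `u` on
  -- both sides.
  set s := M + w₁.length with hs
  have hd := Nat.mod_lt s (show 0 < q n by omega)
  have hdm := Nat.mod_add_div s (q n)
  have he1 : N + 1 ≤ s / q n := by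
    rw [Nat.le_div_iff_mul_le (by omega)]; rw [hs, hM]; nlinarith
  have he2 : s / q n + (N + 1) ≤ u.length := by
    refine le_of_mul_le_mul_left (a := q n) ?_ (by omega)
    rw [mul_add, ← hM]
    omega
  refine ⟨⟨s % q n, hd⟩, translate (s / q n : ℕ) x₀, ?_, ?_⟩
  · rw [word_translate]
    refine preLanguage_of_infix ?_ hu
    conv_rhs => rw [← hx₀]
    exact word_infix _ (by omega) (by push_cast; omega)
  · intro i hi
    rw [abs_le] at hi
    have hNM : N < M := by rw [hM]; nlinarith
    rw [hval i (by omega) (by omega), image_translate _ (by omega), translate]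
    congr 1
    have : (s : ℤ) = (s % q n : ℕ) + q n * (s / q n : ℕ) := by exact_mod_cast hdm.symm
    rw [this]
    push_cast
    ring

end Recognizability

/-! ### Existence of desubstitutions by compactness -/

section Topological

variable {A : Type u} [TopologicalSpace A] [DiscreteTopology A]
  {σ : ℕ → Substitution A} {q : ℕ → ℕ}

theorem continuous_image (τ : Substitution A) (l : ℕ) : Continuous (image τ l) :=
  continuous_pi fun t =>
    (continuous_of_discreteTopology (f := fun a => (τ a).getD (t % l).toNat a)).comp
      (continuous_apply (t / l))

theorem continuous_imageIter (n : ℕ) : Continuous (imageIter σ q n) := by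
  induction n with
  | zero => exact continuous_id
  | succ n ih => exact ih.comp (continuous_image _ _)

theorem isClosed_setOf_word_mem (S : Set (List A)) (k : ℤ) (l : ℕ) :
    IsClosed {x : ℤ → A | word x k l ∈ S} :=
  (isClosed_discrete {f : Fin l → A | List.ofFn f ∈ S}).preimage
    (f := fun x : ℤ → A => fun i : Fin l => x (k + (i : ℕ))) (by fun_prop)

theorem isClosed_shiftSpace (n : ℕ) : IsClosed (shiftSpace σ n) := by
  have : shiftSpace σ n = ⋂ k : ℤ, ⋂ l : ℕ, {x | word x k l ∈ preLanguage σ n} := by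
    ext x; simp [shiftSpace]
  rw [this]
  exact isClosed_iInter fun k => isClosed_iInter fun l => isClosed_setOf_word_mem _ _ _

/-- The solutions on windows of radius `N` form nested nonempty closed subsets of a compact space,
so some pair solves all windows at once. -/
theorem exists_desubstitution [Finite A] (hlen : ConstantLength σ q) (hq : ∀ n, 2 ≤ q n) {n : ℕ}
    {y : ℤ → A} (hy : y ∈ shiftSpace σ n) :
    ∃ (d : ℕ) (x : ℤ → A), x ∈ shiftSpace σ (n + 1) ∧
      y = translate d (image (σ n) (q n) x) := by
  let F : ℕ → Set (Fin (q n) × (ℤ → A)) := fun N =>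
    {p | word p.2 (-N) (2 * N + 1) ∈ preLanguage σ (n + 1) ∧
      ∀ i : ℤ, |i| ≤ N → y i = image (σ n) (q n) p.2 (i + (p.1 : ℕ))}
  have hcl : ∀ N, IsClosed (F N) := by
    intro N
    have h : IsClosed {p : Fin (q n) × (ℤ → A) |
        ∀ i : ℤ, |i| ≤ N → y i = image (σ n) (q n) p.2 (i + (p.1 : ℕ))} := by
      rw [Set.ofPred_forall]
      refine isClosed_iInter fun i => ?_
      rw [Set.ofPred_forall]
      refine isClosed_iInter fun _ => isClosed_eq continuous_const ?_
      refine continuous_prod_of_discrete_left.2 fun d => ?_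
      exact (continuous_apply (i + ((d : ℕ) : ℤ))).comp (continuous_image (σ n) (q n))
    exact ((isClosed_setOf_word_mem (preLanguage σ (n + 1)) (-N) (2 * N + 1)).preimage
      continuous_snd).inter h
  obtain ⟨⟨d, x⟩, h⟩ := IsCompact.nonempty_iInter_of_sequence_nonempty_isCompact_isClosed F
    (fun N p hp => ⟨preLanguage_of_infix (word_infix _ (by push_cast; omega)
      (by push_cast; omega)) hp.1, fun i hi => hp.2 i (hi.trans (by push_cast; omega))⟩)
    (fun N => by
      obtain ⟨d, x, h⟩ := exists_desubstitution_window hlen hq hy N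
      exact ⟨(d, x), h⟩)
    (hcl 0).isCompact hcl
  rw [Set.mem_iInter] at h
  refine ⟨d, x, fun k l => ?_, funext fun i => (h i.natAbs).2 i (by simp)⟩
  have hk := neg_abs_le k
  have hk' := le_abs_self k
  exact preLanguage_of_infix (word_infix _ (by push_cast; omega) (by push_cast; omega))
    (h (k.natAbs + l)).1

theorem exists_representation [Finite A] (hlen : ConstantLength σ q) (hq : ∀ n, 2 ≤ q n)
    {y : ℤ → A} (hy : y ∈ shiftSpace σ 0) (n : ℕ) :
    ∃ (k : ℤ) (x : ℤ → A), x ∈ shiftSpace σ n ∧ y = translate k (imageIter σ q n x) := by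
  induction n with
  | zero => exact ⟨0, y, hy, by simp [imageIter, translate_zero]⟩
  | succ n ih =>
    obtain ⟨k, x, hx, rfl⟩ := ih
    obtain ⟨d, x', hx', rfl⟩ := exists_desubstitution hlen hq hx
    exact ⟨_, x', hx', by rw [imageIter_translate hq, translate_translate, imageIter]⟩

end Topological

/-! ### The residues of a point modulo `q_0 ⋯ q_{n-1}` -/

section Residue

variable {A : Type u} {σ : ℕ → Substitution A} {q : ℕ → ℕ}

/-- A recognizable constant-length directive sequence, with lengths at least `2`. -/
structure Desubstitutable (σ : ℕ → Substitution A) (q : ℕ → ℕ) : Prop where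
  constantLength : ConstantLength σ q
  two_le : ∀ n, 2 ≤ q n
  unique : UniqueDesubstitution σ q

theorem exists_word_eq_of_infix {w : List A} {x : ℤ → A} {k : ℤ} {l : ℕ}
    (h : w <:+: word x k l) :
    ∃ a : ℤ, k ≤ a ∧ a + w.length ≤ k + l ∧ word x a w.length = w := by
  obtain ⟨w₁, w₃, e⟩ := h
  have hl := congrArg List.length e
  simp only [List.length_append, length_word] at hl
  have e' := e
  rw [← hl, word_add, word_add] at e'
  refine ⟨k + w₁.length, by omega, by omega, ?_⟩
  have h1 := List.append_inj_left e' (by simp)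
  exact (List.append_inj_right h1 (by simp)).symm

theorem shiftMap_iterate (y : Shift σ) (d : ℕ) :
    ((shiftMap σ)^[d] y).1 = translate d y.1 := by
  induction d with
  | zero => simp [translate_zero]
  | succ d ih =>
    rw [Function.iterate_succ_apply', Nat.cast_add, Nat.cast_one, add_comm, ← translate_translate,
      ← ih]
    rfl

theorem isOpen_iff_window [TopologicalSpace A] [DiscreteTopology A] {V : Set (Shift σ)}
    (hV : IsOpen V) {y : Shift σ} (hy : y ∈ V) :
    ∃ N : ℕ, ∀ y' : Shift σ, (∀ i : ℤ, |i| ≤ N → y'.1 i = y.1 i) → y' ∈ V := by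
  obtain ⟨W, hW, rfl⟩ := isOpen_induced_iff.1 hV
  obtain ⟨I, u, hu, hI⟩ := isOpen_pi_iff.1 hW y.1 hy
  refine ⟨I.sup Int.natAbs, fun y' h => hI fun i hi => ?_⟩
  rw [h i]
  · exact (hu i hi).2
  · have := Finset.le_sup (f := Int.natAbs) hi
    rw [Int.abs_eq_natAbs]
    exact_mod_cast this

namespace Desubstitutable

theorem lt_of_getElem?_eq_some (H : Desubstitutable σ q) {m i : ℕ} {a c : A}
    (h : (σ m a)[i]? = some c) : i < q m := by
  rw [← H.constantLength m a]
  exact (List.getElem?_eq_some_iff.1 h).1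

variable [Finite A] [TopologicalSpace A] [DiscreteTopology A]

/-- The residue `k` modulo `q_0 ⋯ q_{n-1}` such that `y = T^k σ_{[0,n)}(x)` for some `x` in the
shift of level `n`. -/
noncomputable def residue (H : Desubstitutable σ q) (n : ℕ) (y : Shift σ) :
    ZMod (prodLen q n) :=
  ((exists_representation H.constantLength H.two_le y.2 n).choose : ℤ)

/-- The residue does not depend on the chosen representation, by iterated unique desubstitution. -/
theorem residue_eq (H : Desubstitutable σ q) {n : ℕ} {y : Shift σ} {x : ℤ → A}
    (hx : x ∈ shiftSpace σ n) {k : ℤ} (e : y.1 = translate k (imageIter σ q n x)) :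
    H.residue n y = k := by
  obtain ⟨x', hx', e'⟩ := (exists_representation H.constantLength H.two_le y.2 n).choose_spec
  obtain ⟨d, hd, -⟩ := H.unique.iterate H.constantLength H.two_le n hx' hx (e'.symm.trans e)
  rw [residue, hd, Int.cast_add, Int.cast_mul, Int.cast_natCast, ZMod.natCast_self, zero_mul,
    add_zero]

/-- Every integer lift of the residue is usable: translating `x` by `d` changes the exponent by `q_0
⋯ q_{n-1} d`. -/
theorem exists_eq_translate (H : Desubstitutable σ q) {n : ℕ} {y : Shift σ} {k : ℤ}
    (hk : (k : ZMod (prodLen q n)) = H.residue n y) :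
    ∃ x ∈ shiftSpace σ n, y.1 = translate k (imageIter σ q n x) := by
  obtain ⟨k', x, hx, e⟩ := exists_representation H.constantLength H.two_le y.2 n
  rw [H.residue_eq hx e, ZMod.intCast_eq_intCast_iff_dvd_sub] at hk
  obtain ⟨d, hd⟩ := hk
  refine ⟨translate d x, translate_mem hx d, ?_⟩
  rw [imageIter_translate H.two_le, translate_translate, ← hd, e]
  congr 1
  ring

theorem exists_intCast_eq_residue (H : Desubstitutable σ q) (n : ℕ) (y : Shift σ) :
    ∃ k : ℤ, (k : ZMod (prodLen q n)) = H.residue n y := ⟨_, rfl⟩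

theorem residue_iterate (H : Desubstitutable σ q) (n : ℕ) (y : Shift σ) (d : ℕ) :
    H.residue n ((shiftMap σ)^[d] y) = H.residue n y + d := by
  obtain ⟨k, hk⟩ := H.exists_intCast_eq_residue n y
  obtain ⟨x, hx, e⟩ := H.exists_eq_translate hk
  have e' : ((shiftMap σ)^[d] y).1 = translate (d + k) (imageIter σ q n x) := by
    rw [shiftMap_iterate, e, translate_translate]
  rw [H.residue_eq hx e', ← hk]
  push_cast
  ring

theorem residue_shiftMap (H : Desubstitutable σ q) (n : ℕ) (y : Shift σ) :
    H.residue n (shiftMap σ y) = H.residue n y + 1 := by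
  simpa using H.residue_iterate n y 1

theorem intCast_eq_residue_of_le (H : Desubstitutable σ q) {m n : ℕ} (hmn : m ≤ n) {y : Shift σ}
    {k : ℤ} (hk : (k : ZMod (prodLen q n)) = H.residue n y) :
    (k : ZMod (prodLen q m)) = H.residue m y := by
  induction hmn with
  | refl => exact hk
  | step _ ih =>
    obtain ⟨x, hx, e⟩ := H.exists_eq_translate hk
    exact ih (H.residue_eq (image_mem H.constantLength H.two_le hx) e).symm

theorem residue_eq_of_le (H : Desubstitutable σ q) {m n : ℕ} (hmn : m ≤ n) {y y' : Shift σ}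
    (h : H.residue n y = H.residue n y') : H.residue m y = H.residue m y' := by
  obtain ⟨k, hk⟩ := H.exists_intCast_eq_residue n y
  rw [← H.intCast_eq_residue_of_le hmn hk, ← H.intCast_eq_residue_of_le hmn (hk.trans h)]

instance instCompactSpaceShift : CompactSpace (Shift σ) :=
  isCompact_iff_compactSpace.1 (isClosed_shiftSpace 0).isCompact

/-- Each fibre is the projection, along a compact factor, of a closed set of pairs `(x, y)`, hence
closed; there are finitely many fibres. -/
theorem continuous_residue (H : Desubstitutable σ q) (n : ℕ) : Continuous (H.residue n) := by
  have : NeZero (prodLen q n) := ⟨(prodLen_pos H.two_le n).ne'⟩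
  have hs : ∀ c, IsClosed (H.residue n ⁻¹' {c}) := by
    intro c
    obtain ⟨k, rfl⟩ := ZMod.intCast_surjective c
    have : H.residue n ⁻¹' {(k : ZMod (prodLen q n))} = Prod.snd ''
        {p : (ℤ → A) × Shift σ | p.1 ∈ shiftSpace σ n ∧
          p.2.1 = translate k (imageIter σ q n p.1)} := by
      ext y
      constructor
      · intro h
        obtain ⟨x, hx, e⟩ := H.exists_eq_translate (n := n) (y := y) (k := k) h.symm
        exact ⟨(x, y), ⟨hx, e⟩, rfl⟩
      · rintro ⟨⟨x, y⟩, ⟨hx, e⟩, rfl⟩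
        exact H.residue_eq hx e
    rw [this]
    refine isClosedMap_snd_of_compactSpace _ (((isClosed_shiftSpace n).preimage
      continuous_fst).inter (isClosed_eq (by fun_prop) (continuous_pi fun i => ?_)))
    exact (continuous_apply (i + k)).comp ((continuous_imageIter n).comp continuous_fst)
  refine continuous_iff_isClosed.2 fun S _ => ?_
  rw [← Set.biUnion_preimage_singleton]
  exact S.toFinite.isClosed_biUnion fun c _ => hs c

/-- The points whose residue modulo `q_0 ⋯ q_m` makes the coordinate `j` lie, at level `m`, in a
column of `σ_m` with a coincidence. -/
def hitSet (H : Desubstitutable σ q) (m : ℕ) (j : ℤ) : Set (Shift σ) :=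
  {y | ∃ (i : ℕ) (c : A), (∀ a, (σ m a)[i]? = some c) ∧
    ∃ k : ℤ, (k : ZMod (prodLen q (m + 1))) = H.residue (m + 1) y ∧
      (k + j) / prodLen q m % q m = i}

theorem mem_hitSet_congr (H : Desubstitutable σ q) {m : ℕ} {j : ℤ} {y y' : Shift σ}
    (h : H.residue (m + 1) y = H.residue (m + 1) y') : y ∈ H.hitSet m j ↔ y' ∈ H.hitSet m j := by
  simp only [hitSet, Set.mem_ofPred_eq, h]

theorem mem_hitSet_iterate (H : Desubstitutable σ q) {m : ℕ} {j : ℤ} {y : Shift σ} {d : ℕ} :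
    (shiftMap σ)^[d] y ∈ H.hitSet m j ↔ y ∈ H.hitSet m (j + d) := by
  constructor
  · rintro ⟨i, c, hc, k, hk, h⟩
    refine ⟨i, c, hc, k - d, ?_, by rw [← h]; congr 2; ring⟩
    rw [H.residue_iterate] at hk
    push_cast
    rw [hk]
    ring
  · rintro ⟨i, c, hc, k, hk, h⟩
    refine ⟨i, c, hc, k + d, ?_, by rw [← h]; congr 2; ring⟩
    rw [H.residue_iterate, ← hk]
    push_cast
    ring

theorem isClopen_hitSet (H : Desubstitutable σ q) (m : ℕ) (j : ℤ) : IsClopen (H.hitSet m j) :=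
  (isClopen_discrete {r : ZMod (prodLen q (m + 1)) | ∃ (i : ℕ) (c : A),
    (∀ a, (σ m a)[i]? = some c) ∧ ∃ k : ℤ, (k : ZMod (prodLen q (m + 1))) = r ∧
      (k + j) / prodLen q m % q m = i}).preimage (H.continuous_residue (m + 1))

/-- Both points have the coincidence letter `c` at the level-`m` position above `j`, and that letter
and the offset in its block determine coordinate `j`. -/
theorem eq_of_mem_hitSet (H : Desubstitutable σ q) {m : ℕ} {j : ℤ} {y y' : Shift σ}
    (hy : y ∈ H.hitSet m j) (h : H.residue (m + 1) y = H.residue (m + 1) y') :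
    y.1 j = y'.1 j := by
  obtain ⟨i, c, hc, k, hk, hi⟩ := hy
  have key : ∀ x : ℤ → A, image (σ m) (q m) x ((k + j) / prodLen q m) = c := by
    intro x
    simp only [image, hi, Int.toNat_natCast, List.getD_eq_getElem?_getD, hc, Option.getD_some]
  obtain ⟨x, -, e⟩ := H.exists_eq_translate hk
  obtain ⟨x', -, e'⟩ := H.exists_eq_translate (hk.trans h)
  rw [e, e']
  simp only [translate, imageIter, add_comm j k]
  exact imageIter_congr m (by rw [key, key])

/-- The coincidence column recurs in every level-`m` block `σ_m(a)`, and each occurrence expands to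
`q_0 ⋯ q_{m-1}` consecutive coordinates. -/
theorem exists_interval_hitSet (H : Desubstitutable σ q) {m : ℕ} (hm : HasCoincidence (σ m))
    (y : Shift σ) (b : ℤ) :
    ∃ s : ℤ, b ≤ s ∧ ∀ j, s ≤ j → j < s + prodLen q m → y ∈ H.hitSet m j := by
  obtain ⟨i, c, hc⟩ := hm
  have hi := H.lt_of_getElem?_eq_some (hc (y.1 0))
  obtain ⟨k, hk⟩ := H.exists_intCast_eq_residue (m + 1) y
  have hP := prodLen_pos H.two_le m
  have hP' : (0 : ℤ) < prodLen q m := by exact_mod_cast hP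
  have hq : (2 : ℤ) ≤ q m := by exact_mod_cast H.two_le m
  -- Any large block index would do; this one puts the interval to the right of `b` after
  -- subtracting `k`.
  set t : ℤ := |k| + |b| with ht
  have ht0 : 0 ≤ t := by positivity
  have hk' := neg_abs_le k
  have hk'' := le_abs_self k
  have hb' := le_abs_self b
  have h1 : t ≤ prodLen q m * (i + q m * t) := by
    have : t ≤ i + q m * t := by nlinarith
    nlinarith
  refine ⟨prodLen q m * (i + q m * t) - k, by linarith, fun j h2 h3 => ⟨i, c, hc, k, hk, ?_⟩⟩
  have h4 : (k + j) / prodLen q m = i + q m * t := by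
    rw [Int.ediv_eq_iff_of_pos hP']
    constructor <;> linarith
  rw [h4, Int.add_mul_emod_self_left, Int.emod_eq_of_lt (by omega) (by omega)]

/-- A shift by `q_0 ⋯ q_{m-1}` moves the level-`m` position by one, so `q_m` successive shifts visit
every column. -/
theorem exists_lt_mem_hitSet (H : Desubstitutable σ q) {m : ℕ} (hm : HasCoincidence (σ m))
    (y : Shift σ) (j : ℤ) : ∃ t < q m, (shiftMap σ)^[t * prodLen q m] y ∈ H.hitSet m j := by
  obtain ⟨i, c, hc⟩ := hm
  have hi := H.lt_of_getElem?_eq_some (hc (y.1 0))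
  obtain ⟨k, hk⟩ := H.exists_intCast_eq_residue (m + 1) y
  have hP : (prodLen q m : ℤ) ≠ 0 := by exact_mod_cast (prodLen_pos H.two_le m).ne'
  have hq : (0 : ℤ) < q m := by have := H.two_le m; omega
  obtain ⟨t, ht⟩ := Int.eq_ofNat_of_zero_le
    (Int.emod_nonneg (i - (k + j) / prodLen q m) hq.ne')
  have ht' := Int.emod_lt_of_pos (i - (k + j) / prodLen q m) hq
  refine ⟨t, by omega, H.mem_hitSet_iterate.2 ⟨i, c, hc, k, hk, ?_⟩⟩
  rw [← add_assoc, Nat.cast_mul, Int.add_mul_ediv_right _ _ hP, ← ht, Int.add_emod_emod,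
    add_sub_cancel, Int.emod_eq_of_lt (by omega) (by omega)]

/-- Every word of the level-`0` language occurs with bounded gaps in the points of `X_σ`. -/
theorem exists_gap (H : Desubstitutable σ q) (hprim : Primitive σ) {w : List A}
    (hw : w ∈ preLanguage σ 0) :
    ∃ L : ℕ, ∀ (y : Shift σ) (s : ℤ), ∃ a, s ≤ a ∧ a < s + L ∧ word y.1 a w.length = w := by
  obtain ⟨n, hn⟩ := exists_forall_infix_block hprim hw
  have hP := prodLen_pos H.two_le n
  have hP' : (0 : ℤ) < prodLen q n := by exact_mod_cast hP
  -- One block length reaches the next block boundary, another covers the block containing `w`; the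
  -- `1` makes the inequality strict even for empty `w`.
  refine ⟨2 * prodLen q n + 1, fun y s => ?_⟩
  obtain ⟨k, x, hx, e⟩ := exists_representation H.constantLength H.two_le y.2 n
  have h := word_imageIter H.constantLength n x ((s + k) / prodLen q n + 1) 1
  rw [word_one, List.flatMap_singleton, mul_one] at h
  obtain ⟨a, h1, h2, h3⟩ := exists_word_eq_of_infix (h ▸ hn (x ((s + k) / prodLen q n + 1)))
  have h4 := Int.lt_mul_ediv_self_add (x := s + k) hP'
  have h5 := Int.mul_ediv_self_le (x := s + k) hP'.ne'
  rw [mul_add, mul_one] at h1 h2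
  refine ⟨a - k, by linarith, ?_, ?_⟩
  · rw [Nat.cast_add, Nat.cast_mul]
    push_cast at h1 h2 h4 h5 ⊢
    linarith
  · rw [e, word_translate, sub_add_cancel, h3]

end Desubstitutable

end Residue

/-! ### Odometers as equicontinuous systems -/

theorem Odometer.addOne_zpow_apply (r : ℕ → ℕ) (n : ℤ) (z : Odometer r) :
    (Odometer.addOne r ^ n) z = z + n • Odometer.unit r := by
  induction n generalizing z with
  | zero => rw [zpow_zero, zero_smul, add_zero]; rfl
  | succ n ih =>
    rw [zpow_add_one, add_smul, one_smul]
    change (Odometer.addOne r ^ (n : ℤ)) (z + Odometer.unit r) = _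
    rw [ih]
    abel
  | pred n ih =>
    rw [zpow_sub_one, sub_smul, one_smul]
    change (Odometer.addOne r ^ (-n : ℤ)) ((Homeomorph.addRight (Odometer.unit r)).symm z) = _
    rw [ih, Homeomorph.addRight_symm]
    change z + -Odometer.unit r + _ = _
    abel

/-- All powers are translations, which preserve differences and hence the group uniformity. -/
theorem Odometer.isEquicontinuousSystem (r : ℕ → ℕ) [CompactSpace (Odometer r)] :
    IsEquicontinuousSystem (Odometer.addOne r) := by
  refine ⟨inferInstance, inferInstance, IsTopologicalAddGroup.rightUniformSpace _, rfl, ?_⟩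
  let _ := IsTopologicalAddGroup.rightUniformSpace (Odometer r)
  have : IsUniformAddGroup (Odometer r) := isUniformAddGroup_of_addCommGroup
  intro z U hU
  rw [uniformity_eq_comap_nhds_zero] at hU
  obtain ⟨V, hV, hVU⟩ := hU
  have hc : Tendsto (fun x : Odometer r => x - z) (𝓝 z) (𝓝 0) := by
    have : Continuous fun x : Odometer r => x - z := by fun_prop
    simpa using this.tendsto z
  filter_upwards [hc hV] with x hx n
  refine hVU ?_
  simpa [Odometer.addOne_zpow_apply] using hx

/-! ### The factor map onto the odometer and its fibres -/

section Topological

variable {A : Type u} [Finite A] [TopologicalSpace A] [DiscreteTopology A]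
  {σ : ℕ → Substitution A} {q : ℕ → ℕ}

namespace Desubstitutable

/-- The map from `X_σ` to the odometer of a sequence `r` such that `r_0 ⋯ r_{n-1}` divides
`q_0 ⋯ q_{n-1}` for all `n`. -/
noncomputable def odometerMap (H : Desubstitutable σ q) {r : ℕ → ℕ}
    (hr : ∀ n, prodLen r n ∣ prodLen q n) (y : Shift σ) : Odometer r :=
  ⟨fun n => ZMod.castHom (hr n) _ (H.residue n y), fun n => by
    obtain ⟨k, hk⟩ := H.exists_intCast_eq_residue (n + 1) y
    simp only [← hk, ← H.intCast_eq_residue_of_le n.le_succ hk, map_intCast]⟩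

theorem odometerMap_apply (H : Desubstitutable σ q) {r : ℕ → ℕ}
    (hr : ∀ n, prodLen r n ∣ prodLen q n) (y : Shift σ) (n : ℕ) :
    (H.odometerMap hr y).1 n = ZMod.castHom (hr n) _ (H.residue n y) := rfl

/-- Only cofinality of the two divisibility chains matters. This allows `r = (1, q_0, q_1, …)`,
whose partial products lag one index behind those of `q`. -/
theorem residue_eq_of_odometerMap_eq (H : Desubstitutable σ q) {r : ℕ → ℕ}
    (hr : ∀ n, prodLen r n ∣ prodLen q n) (hr' : ∀ n, ∃ m, prodLen q n ∣ prodLen r m)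
    {y y' : Shift σ} (h : H.odometerMap hr y = H.odometerMap hr y') (n : ℕ) :
    H.residue n y = H.residue n y' := by
  obtain ⟨m, hm⟩ := hr' n
  have hN := congrFun (congrArg Subtype.val h) (max n m)
  obtain ⟨k, hk⟩ := H.exists_intCast_eq_residue (max n m) y
  obtain ⟨k', hk'⟩ := H.exists_intCast_eq_residue (max n m) y'
  rw [odometerMap_apply, odometerMap_apply, ← hk, ← hk', map_intCast, map_intCast,
    ZMod.intCast_eq_intCast_iff_dvd_sub] at hN
  rw [← H.intCast_eq_residue_of_le (le_max_left n m) hk,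
    ← H.intCast_eq_residue_of_le (le_max_left n m) hk', ZMod.intCast_eq_intCast_iff_dvd_sub]
  exact (Int.natCast_dvd_natCast.2 (hm.trans (prodLen_dvd r (le_max_right n m)))).trans hN

theorem isFactorMap_odometerMap (H : Desubstitutable σ q) [Nonempty (Shift σ)] {r : ℕ → ℕ}
    (hr : ∀ n, prodLen r n ∣ prodLen q n) :
    IsFactorMap (shiftMap σ) (Odometer.addOne r) (H.odometerMap hr) := by
  have hcont : ∀ n, Continuous fun y => (H.odometerMap hr y).1 n := fun n =>
    (continuous_of_discreteTopology (f := ZMod.castHom (hr n) (ZMod (prodLen r n)))).comp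
      (H.continuous_residue n)
  refine ⟨(continuous_pi hcont).subtype_mk _, fun z => ?_, fun y => Subtype.ext (funext fun n => ?_)⟩
  -- Surjectivity by compactness: each finite set of compatible residues is attained along any
  -- orbit, because the shift adds `1`.
  · let C : ℕ → Set (Shift σ) := fun n => {y | (H.odometerMap hr y).1 n = z.1 n}
    have hC : ∀ n, IsClosed (C n) := fun n => isClosed_eq (hcont n) continuous_const
    obtain ⟨y, hy⟩ := IsCompact.nonempty_iInter_of_sequence_nonempty_isCompact_isClosed C
      (fun n y hy => by
        have h : (H.odometerMap hr y).1 (n + 1) = z.1 (n + 1) := hy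
        change _ = _
        rw [← (H.odometerMap hr y).2 n, h, z.2 n])
      (fun n => by
        have : NeZero (prodLen r n) :=
          ⟨(Nat.pos_of_dvd_of_pos (hr n) (prodLen_pos H.two_le n)).ne'⟩
        obtain ⟨y⟩ := ‹Nonempty (Shift σ)›
        obtain ⟨j, hj⟩ := ZMod.natCast_zmod_surjective (z.1 n - (H.odometerMap hr y).1 n)
        refine ⟨(shiftMap σ)^[j] y, ?_⟩
        change _ = _
        rw [odometerMap_apply, residue_iterate, map_add, map_natCast, hj, odometerMap_apply]
        ring)
      (hC 0).isCompact hC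
    exact ⟨y, Subtype.ext (funext fun n => Set.mem_iInter.1 hy n)⟩
  · rw [odometerMap_apply, residue_shiftMap, map_add, map_one]
    rfl

theorem compactSpace_odometer (H : Desubstitutable σ q) [Nonempty (Shift σ)] {r : ℕ → ℕ}
    (hr : ∀ n, prodLen r n ∣ prodLen q n) : CompactSpace (Odometer r) :=
  (H.isFactorMap_odometerMap hr).surjective.compactSpace (H.isFactorMap_odometerMap hr).continuous

/-- A word of `y` recurs with gaps below `L`, while a coincidence level `m > L` gives an interval of
determined coordinates longer than `L`. So some shift of `y` shows the same central word and moves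
`j` into that interval. -/
theorem dense_iUnion_hitSet (H : Desubstitutable σ q) (hprim : Primitive σ)
    (hcoin : {n | HasCoincidence (σ n)}.Infinite) (j : ℤ) : Dense (⋃ m, H.hitSet m j) := by
  refine dense_iff_inter_open.2 fun V hV ⟨y, hy⟩ => ?_
  obtain ⟨N, hN⟩ := isOpen_iff_window hV hy
  obtain ⟨L, hL⟩ := H.exists_gap hprim (y.2 (-N) (2 * N + 1))
  obtain ⟨m, hm, hmL⟩ := hcoin.exists_gt L
  obtain ⟨s, hs, hs'⟩ := H.exists_interval_hitSet hm y |j|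
  obtain ⟨a, h1, h2, h3⟩ := hL y (s - j - N)
  have hP := lt_prodLen H.two_le m
  have hj := le_abs_self j
  obtain ⟨d, hd⟩ := Int.eq_ofNat_of_zero_le (show 0 ≤ a + N by omega)
  refine ⟨(shiftMap σ)^[d] y, hN _ fun i hi => ?_, Set.mem_iUnion.2 ⟨m, ?_⟩⟩
  · rw [abs_le] at hi
    obtain ⟨e, he⟩ := Int.eq_ofNat_of_zero_le (show 0 ≤ i + N by omega)
    rw [length_word] at h3
    have h4 : (word y.1 a (2 * N + 1))[e]'(by simp; omega) =
        (word y.1 (-N) (2 * N + 1))[e]'(by simp; omega) := by simp only [h3]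
    rw [getElem_word, getElem_word] at h4
    rw [shiftMap_iterate, translate]
    convert h4 using 2 <;> omega
  · rw [mem_hitSet_iterate]
    refine hs' _ (by omega) ?_
    have : (m : ℤ) < prodLen q m := by exact_mod_cast hP
    omega

theorem isToeplitz (H : Desubstitutable σ q) [Nonempty (Shift σ)] (hprim : Primitive σ)
    (hcoin : {n | HasCoincidence (σ n)}.Infinite) : IsToeplitz (shiftMap σ) := by
  refine ⟨q, H.two_le, H.odometerMap fun _ => dvd_rfl, H.isFactorMap_odometerMap _, ?_⟩
  refine (dense_iInter_of_isOpen (f := fun j : ℤ => ⋃ m, H.hitSet m j)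
    (fun j => isOpen_iUnion fun m => (H.isClopen_hitSet m j).isOpen)
    (H.dense_iUnion_hitSet hprim hcoin)).mono fun y hy => ?_
  refine Set.eq_singleton_iff_unique_mem.2 ⟨rfl, fun y' hy' => Subtype.ext (funext fun j => ?_)⟩
  obtain ⟨m, hm⟩ := Set.mem_iUnion.1 (Set.mem_iInter.1 hy j)
  exact (H.eq_of_mem_hitSet hm
    (H.residue_eq_of_odometerMap_eq _ (fun n => ⟨n, dvd_rfl⟩) hy' (m + 1)).symm).symm

/-- This is proximality of points with equal residues: the determined interval at a deep coincidence
level is longer than the window, and both points carry the same letters there. -/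
theorem exists_agree (H : Desubstitutable σ q)
    (hcoin : {n | HasCoincidence (σ n)}.Infinite) (N : ℕ) :
    ∃ m, ∀ y y' : Shift σ, H.residue m y = H.residue m y' →
      ∃ d : ℕ, ∀ i : ℤ, |i| ≤ N → ((shiftMap σ)^[d] y).1 i = ((shiftMap σ)^[d] y').1 i := by
  obtain ⟨m, hm, hmL⟩ := hcoin.exists_gt (2 * N + 1)
  refine ⟨m + 1, fun y y' h => ?_⟩
  obtain ⟨s, hs, hs'⟩ := H.exists_interval_hitSet hm y 0
  obtain ⟨d, hd⟩ := Int.eq_ofNat_of_zero_le (show 0 ≤ s + N by omega)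
  refine ⟨d, fun i hi => ?_⟩
  rw [abs_le] at hi
  rw [shiftMap_iterate, shiftMap_iterate]
  refine H.eq_of_mem_hitSet (hs' _ (by omega) ?_) h
  have : (m : ℤ) < prodLen q m := by exact_mod_cast lt_prodLen H.two_le m
  omega

/-- Limits along one fixed ultrafilter replace convergent subsequences chosen for both sequences. -/
theorem exists_common_limit {y y' : ℕ → Shift σ}
    (h : ∀ N : ℕ, ∀ i : ℤ, |i| ≤ N → (y N).1 i = (y' N).1 i) :
    ∃ p, Tendsto y (hyperfilter ℕ) (𝓝 p) ∧ Tendsto y' (hyperfilter ℕ) (𝓝 p) := by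
  have hp : Tendsto y (hyperfilter ℕ) (𝓝 ((hyperfilter ℕ).map y).lim) :=
    ((hyperfilter ℕ).map y).le_nhds_lim
  have hp' : Tendsto y' (hyperfilter ℕ) (𝓝 ((hyperfilter ℕ).map y').lim) :=
    ((hyperfilter ℕ).map y').le_nhds_lim
  refine ⟨_, hp, ?_⟩
  convert hp' using 2
  refine Subtype.ext (funext fun i => ?_)
  have hi : Continuous fun x : Shift σ => x.1 i :=
    (continuous_apply i).comp continuous_subtype_val
  have h1 := ((hi.tendsto _).comp hp).eventually (eventually_nhds_iff.2
    ⟨{_}, fun a ha => Set.mem_singleton_iff.1 ha, isOpen_discrete _, Set.mem_singleton _⟩)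
  have h2 := ((hi.tendsto _).comp hp').eventually (eventually_nhds_iff.2
    ⟨{_}, fun a ha => Set.mem_singleton_iff.1 ha, isOpen_discrete _, Set.mem_singleton _⟩)
  have h3 : ∀ᶠ N : ℕ in hyperfilter ℕ, i.natAbs ≤ N :=
    Nat.hyperfilter_le_atTop (eventually_ge_atTop _)
  obtain ⟨N, ⟨e1, e2⟩, e3⟩ := ((h1.and h2).and h3).exists
  simp only [Function.comp_apply] at e1 e2
  rw [← e1, ← e2, h N i (by rw [Int.abs_eq_natAbs]; exact_mod_cast e3)]

/-- The shifts `T^d y` and `T^d y'` have a common limit, so their images come arbitrarily close;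
uniform equicontinuity of the powers `R^{-d}` carries this closeness back to `φ y` and `φ y'`. -/
theorem apply_eq_of_residue_eq (H : Desubstitutable σ q)
    (hcoin : {n | HasCoincidence (σ n)}.Infinite) {Y : Type w} [t : TopologicalSpace Y] {R : Y ≃ₜ Y}
    (hR : IsEquicontinuousSystem R) {φ : Shift σ → Y} (hφ : Continuous φ)
    (hφR : Function.Semiconj φ (shiftMap σ) R) {y y' : Shift σ}
    (h : ∀ n, H.residue n y = H.residue n y') : φ y = φ y' := by
  obtain ⟨hc, hT2, U, rfl, hE⟩ := hR
  choose m hm using H.exists_agree hcoin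
  choose d hd using fun N => hm N y y' (h _)
  obtain ⟨p, hp, hp'⟩ := exists_common_limit hd
  have hE' := CompactSpace.uniformEquicontinuous_of_equicontinuous hE
  have hpow : ∀ (n : ℕ) (x : Y), (R ^ (-n : ℤ)) (R^[n] x) = x := by
    intro n x
    have h1 : ∀ z, R^[n] z = (R ^ (n : ℤ)) z := by
      induction n with
      | zero => intro z; rfl
      | succ n ih =>
        intro z
        rw [Function.iterate_succ_apply, ih, Nat.cast_add, Nat.cast_one, zpow_add_one]
        rfl
    rw [h1]
    change (R ^ (-n : ℤ) * R ^ (n : ℤ)) x = x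
    rw [zpow_neg, inv_mul_cancel]
    rfl
  refine eq_of_uniformity fun {V} hV => ?_
  have h1 := hE' V hV
  have h2 : Tendsto (fun N => (φ ((shiftMap σ)^[d N] y), φ ((shiftMap σ)^[d N] y')))
      (hyperfilter ℕ) (uniformity Y) :=
    ((hφ.tendsto p).comp hp |>.prodMk_nhds ((hφ.tendsto p).comp hp')).mono_right
      (nhds_le_uniformity _)
  obtain ⟨N, hN⟩ := (h2.eventually h1).exists
  have h3 := hN (-(d N : ℤ))
  simp only [(hφR.iterate_right (d N)).eq, hpow] at h3
  exact h3

theorem isMaximalEquicontinuousFactor (H : Desubstitutable σ q) [Nonempty (Shift σ)]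
    (hcoin : {n | HasCoincidence (σ n)}.Infinite) {r : ℕ → ℕ}
    (hr : ∀ n, prodLen r n ∣ prodLen q n) (hr' : ∀ n, ∃ m, prodLen q n ∣ prodLen r m) :
    IsMaximalEquicontinuousFactor.{u, 0, w} (shiftMap σ) (Odometer.addOne r) := by
  have hπ := H.isFactorMap_odometerMap hr
  have := H.compactSpace_odometer hr
  refine ⟨Odometer.isEquicontinuousSystem r, _, hπ, fun Y _ R hR φ hφ => ?_⟩
  have hsec := Function.surjInv_eq hπ.surjective
  have hψ : φ = (φ ∘ Function.surjInv hπ.surjective) ∘ H.odometerMap hr := funext fun y =>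
    H.apply_eq_of_residue_eq hcoin hR hφ.continuous hφ.semiconj
      (H.residue_eq_of_odometerMap_eq hr hr' (hsec _).symm)
  refine ⟨φ ∘ Function.surjInv hπ.surjective, ⟨?_, ?_, ?_⟩, hψ⟩
  -- A continuous surjection from a compact space to a Hausdorff one is a quotient map, so `ψ`
  -- inherits continuity from `φ`.
  · refine (hπ.continuous.isClosedMap.isQuotientMap hπ.continuous hπ.surjective).continuous_iff.2 ?_
    rw [← hψ]
    exact hφ.continuous
  · refine Function.Surjective.of_comp (g := H.odometerMap hr) ?_
    rw [← hψ]
    exact hφ.surjective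
  · intro z
    obtain ⟨y, rfl⟩ := hπ.surjective z
    have h1 := congrFun hψ y
    have h2 := congrFun hψ (shiftMap σ y)
    simp only [Function.comp_apply] at h1 h2 ⊢
    rw [← hπ.semiconj.eq, ← h2, ← h1, hφ.semiconj.eq]

/-! ### The height -/

theorem eq_one_of_mem_coprimeOrders (H : Desubstitutable σ q)
    (hcoin : {n | HasCoincidence (σ n)}.Infinite) {e : ℕ}
    (he : e ∈ coprimeOrders (shiftMap σ) q) : e = 1 := by
  obtain ⟨he0, hcop, l, hl, f, hf, hf0, hfl⟩ := he
  obtain ⟨y, hy⟩ := Function.ne_iff.1 hf0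
  have hit : ∀ n x, f ((shiftMap σ)^[n] x) = l ^ n * f x := by
    intro n x
    induction n with
    | zero => simp
    | succ n ih => rw [Function.iterate_succ_apply', hfl, ih, pow_succ]; ring
  have hl1 : ‖l‖ = 1 := hl.norm'_eq_one he0.ne'
  choose m hm using H.exists_agree hcoin
  -- Shifting by `q_0 ⋯ q_{m-1}` preserves the residue at level `m`, so `y` and this shift agree on
  -- long windows somewhere along the orbit.
  choose d hd using fun N => hm N y ((shiftMap σ)^[prodLen q (m N)] y) (by
    rw [residue_iterate, ZMod.natCast_self, add_zero])
  obtain ⟨p, hp, hp'⟩ := exists_common_limit hd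
  have h1 : Tendsto (fun N => ‖l ^ prodLen q (m N) - 1‖ * ‖f y‖) (hyperfilter ℕ) (𝓝 0) := by
    have := (((hf.tendsto p).comp hp').sub ((hf.tendsto p).comp hp)).norm
    rw [sub_self, norm_zero] at this
    refine this.congr fun N => ?_
    simp only [Function.comp_apply, hit]
    rw [← mul_sub, ← sub_one_mul, norm_mul, norm_mul, norm_pow, hl1, one_pow, one_mul]
  have h2 : Tendsto (fun N => l ^ prodLen q (m N)) (hyperfilter ℕ) (𝓝 1) := by
    rw [tendsto_iff_norm_sub_tendsto_zero]
    have h0 : ‖f y‖ ≠ 0 := norm_ne_zero_iff.2 hy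
    simpa [h0] using h1.div_const ‖f y‖
  -- A root of unity has finitely many powers, so powers converging to `1` must attain `1`.
  have hfin : (Set.range fun n : ℕ => l ^ n).Finite := by
    refine ((Finset.range e).image fun n => l ^ n).finite_toSet.subset ?_
    rintro _ ⟨n, rfl⟩
    rw [Finset.mem_coe, Finset.mem_image]
    exact ⟨n % e, Finset.mem_range.2 (Nat.mod_lt _ he0), by
      rw [hl.eq_orderOf]; exact pow_mod_orderOf l n⟩
  have hcl : IsClosed ((Set.range fun n : ℕ => l ^ n) \ {1}) :=
    (hfin.subset Set.sdiff_subset).isClosed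
  obtain ⟨N, hN⟩ := (h2.eventually (hcl.isOpen_compl.mem_nhds (by simp))).exists
  have h3 : l ^ prodLen q (m N) = 1 := by
    by_contra hne
    exact hN ⟨⟨_, rfl⟩, hne⟩
  exact Nat.Coprime.eq_one_of_dvd (Nat.Coprime.prod_right fun i _ => hcop i)
    (hl.dvd_of_pow_eq_one _ h3)

theorem height_eq_one (H : Desubstitutable σ q)
    (hcoin : {n | HasCoincidence (σ n)}.Infinite) : height (shiftMap σ) q = 1 := by
  have h1 : 1 ∈ {m | 0 < m ∧ ∀ d ∈ coprimeOrders (shiftMap σ) q, d ∣ m} :=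
    ⟨one_pos, fun d hd => (H.eq_one_of_mem_coprimeOrders hcoin hd).dvd⟩
  exact le_antisymm (Nat.sInf_le h1) (Nat.sInf_mem ⟨1, h1⟩).1

end Desubstitutable

end Topological

/-! ### Discrete spectrum -/

/-! ### Eigenfunctions from finite cyclic factors -/

section FiniteCyclicFactor

variable {X : Type u} [MeasurableSpace X] {T : X → X} {μ : Measure X} [IsProbabilityMeasure μ]

theorem memLp_comp_of_finite {Z : Type*} [Finite Z] [MeasurableSpace Z] [DiscreteMeasurableSpace Z]
    {κ : X → Z} (hκ : Measurable κ) (g : Z → ℂ) : MemLp (g ∘ κ) 2 μ := by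
  obtain ⟨C, hC⟩ := (Set.finite_range fun z => ‖g z‖).bddAbove
  refine MemLp.of_bound
    ((Measurable.of_discrete.comp hκ).aestronglyMeasurable) C
    (ae_of_all _ fun x => hC ⟨κ x, rfl⟩)

/-- A function of a measurable factor map onto a finite cyclic system lies in the span of the
eigenfunctions. -/
theorem toLp_comp_mem_iSup_eigenspace (hT : MeasurePreserving T μ μ) {P : ℕ} [NeZero P]
    [MeasurableSpace (ZMod P)] [DiscreteMeasurableSpace (ZMod P)] {κ : X → ZMod P}
    (hκ : Measurable κ) (hκT : ∀ x, κ (T x) = κ x + 1) (g : ZMod P → ℂ) :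
    (memLp_comp_of_finite (μ := μ) hκ g).toLp ∈ ⨆ l : ℂ, Module.End.eigenspace
      (Lp.compMeasurePreservingₗᵢ (E := ℂ) (p := 2) ℂ T hT).toLinearMap l := by
  set W := ⨆ l : ℂ, Module.End.eigenspace
      (Lp.compMeasurePreservingₗᵢ (E := ℂ) (p := 2) ℂ T hT).toLinearMap l
  let Φ : (ZMod P → ℂ) →ₗ[ℂ] Lp ℂ 2 μ :=
    { toFun := fun g => (memLp_comp_of_finite (μ := μ) hκ g).toLp
      map_add' := fun _ _ => rfl
      map_smul' := fun _ _ => rfl }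
  change g ∈ W.comap Φ
  suffices h : ⊤ ≤ W.comap Φ from h trivial
  -- Characters span the functions on `ZMod P`, and `χ ∘ κ` is an eigenfunction with eigenvalue `χ
  -- 1`.
  rw [← (AddChar.complexBasis (ZMod P)).span_eq, Submodule.span_le]
  rintro _ ⟨χ, rfl⟩
  rw [AddChar.coe_complexBasis]
  refine Submodule.mem_iSup_of_mem (χ 1) (Module.End.mem_eigenspace_iff.2 ?_)
  change Lp.compMeasurePreserving T hT (memLp_comp_of_finite hκ χ).toLp = χ 1 • Φ χ
  rw [Lp.toLp_compMeasurePreserving, ← map_smul]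
  change _ = (memLp_comp_of_finite hκ (χ 1 • ⇑χ)).toLp
  refine (MemLp.toLp_eq_toLp_iff _ _).2 (Eventually.of_forall fun x => ?_)
  simp [hκT, AddChar.map_add_eq_mul, mul_comm]

end FiniteCyclicFactor

/-! ### Density in `L²` from a generating π-system -/

section IndicatorDense

variable {X : Type u} [mX : MeasurableSpace X] {μ : Measure X} [IsProbabilityMeasure μ]

/-- The measurable sets all of whose indicator functions lie in the subspace `D` of `L²`. -/
def IndicatorsMem (D : Submodule ℂ (Lp ℂ 2 μ)) (s : Set X) : Prop :=
  ∃ hs : MeasurableSet s, ∀ c : ℂ, indicatorConstLp 2 hs (measure_ne_top μ s) c ∈ D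

theorem IndicatorsMem.congr {D : Submodule ℂ (Lp ℂ 2 μ)} {s t : Set X} (h : IndicatorsMem D s)
    (ht : MeasurableSet t) (hst : t =ᵐ[μ] s) : IndicatorsMem D t := by
  obtain ⟨hs, h⟩ := h
  refine ⟨ht, fun c => ?_⟩
  have : indicatorConstLp 2 ht (measure_ne_top μ t) c =
      indicatorConstLp 2 hs (measure_ne_top μ s) c :=
    (MemLp.toLp_eq_toLp_iff _ _).2 (indicator_ae_eq_of_ae_eq_set hst)
  rw [this]
  exact h c

theorem IndicatorsMem.disjoint_union {D : Submodule ℂ (Lp ℂ 2 μ)} {s t : Set X}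
    (hs : IndicatorsMem D s) (ht : IndicatorsMem D t) (hst : Disjoint s t) :
    IndicatorsMem D (s ∪ t) := by
  obtain ⟨hs, hs'⟩ := hs
  obtain ⟨ht, ht'⟩ := ht
  refine ⟨hs.union ht, fun c => ?_⟩
  rw [indicatorConstLp_disjoint_union hs ht (measure_ne_top μ s) (measure_ne_top μ t) hst]
  exact D.add_mem (hs' c) (ht' c)

theorem IndicatorsMem.compl {D : Submodule ℂ (Lp ℂ 2 μ)} {s : Set X}
    (huniv : IndicatorsMem D Set.univ) (hs : IndicatorsMem D s) : IndicatorsMem D sᶜ := by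
  obtain ⟨hs, hs'⟩ := hs
  obtain ⟨_, hu'⟩ := huniv
  refine ⟨hs.compl, fun c => ?_⟩
  have := indicatorConstLp_disjoint_union (p := 2) hs hs.compl (measure_ne_top μ s)
    (measure_ne_top μ sᶜ) disjoint_compl_right c
  simp only [Set.union_compl_self] at this
  rw [← sub_eq_iff_eq_add'.2 this]
  exact D.sub_mem (hu' c) (hs' c)

/-- Finite partial unions differ from the full union by sets decreasing to `∅`, so their indicators
converge in `L²` and the closed subspace keeps the limit. -/
theorem IndicatorsMem.iUnion {D : Submodule ℂ (Lp ℂ 2 μ)} (hD : IsClosed (D : Set (Lp ℂ 2 μ)))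
    (hempty : IndicatorsMem D ∅) {f : ℕ → Set X} (hf : ∀ n, IndicatorsMem D (f n))
    (hdisj : Pairwise (Function.onFun Disjoint f)) : IndicatorsMem D (⋃ n, f n) := by
  have ht : ∀ n, IndicatorsMem D (⋃ i, ⋃ (_ : i < n), f i) := by
    intro n
    induction n with
    | zero => simpa using hempty
    | succ n ih =>
      rw [Set.biUnion_lt_succ]
      refine ih.disjoint_union (hf n) ?_
      simp only [Set.disjoint_iUnion_left]
      exact fun i hi => hdisj hi.ne
  have hm : MeasurableSet (⋃ n, f n) := MeasurableSet.iUnion fun n => (hf n).1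
  refine ⟨hm, fun c => hD.mem_of_tendsto (tendsto_indicatorConstLp_set (l := atTop)
    (t := fun n => ⋃ i, ⋃ (_ : i < n), f i) (ht := fun n => (ht n).1)
    (hμt := fun n => measure_ne_top μ _) (by simp) ?_) (Eventually.of_forall fun n => (ht n).2 c)⟩
  have h1 : ∀ n, symmDiff (⋃ i, ⋃ (_ : i < n), f i) (⋃ n, f n) =
      (⋃ n, f n) \ ⋃ i, ⋃ (_ : i < n), f i := fun n =>
    symmDiff_of_le (Set.iUnion₂_subset fun i _ => Set.subset_iUnion f i)
  simp only [h1]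
  have h2 := tendsto_measure_iInter_atTop (μ := μ)
    (s := fun n => (⋃ n, f n) \ ⋃ i, ⋃ (_ : i < n), f i)
    (fun n => (hm.diff (ht n).1).nullMeasurableSet)
    (fun m n hmn => Set.sdiff_subset_sdiff_right
      (Set.biUnion_subset_biUnion_left fun i (hi : i < m) => hi.trans_le hmn))
    ⟨0, measure_ne_top μ _⟩
  have h3 : ⋂ n, ((⋃ n, f n) \ ⋃ i, ⋃ (_ : i < n), f i) = ∅ := by
    refine Set.eq_empty_iff_forall_notMem.2 fun x hx => ?_
    rw [Set.mem_iInter] at hx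
    obtain ⟨i, hi⟩ := Set.mem_iUnion.1 (hx 0).1
    exact (hx (i + 1)).2 (Set.mem_iUnion₂.2 ⟨i, i.lt_succ_self, hi⟩)
  rw [h3, measure_empty] at h2
  exact h2

/-- A closed subspace of `L²` that contains the indicator functions of a π-system generating the
σ-algebra modulo null sets is the whole space. -/
theorem eq_top_of_indicatorsMem {D : Submodule ℂ (Lp ℂ 2 μ)} (hD : IsClosed (D : Set (Lp ℂ 2 μ)))
    {S : Set (Set X)} (hS : IsPiSystem S) (hSD : ∀ s ∈ S, IndicatorsMem D s)
    (huniv : Set.univ ∈ S)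
    (hgen : mX ≤ eventuallyMeasurableSpace (MeasurableSpace.generateFrom S) (ae μ)) : D = ⊤ := by
  have hempty : IndicatorsMem D ∅ :=
    ⟨MeasurableSet.empty, fun c => by rw [indicatorConstLp_empty]; exact D.zero_mem⟩
  have h0 : ∀ s, MeasurableSet[MeasurableSpace.generateFrom S] s → IndicatorsMem D s :=
    MeasurableSpace.induction_on_inter (C := fun s _ => IndicatorsMem D s) rfl hS hempty hSD
      (fun s _ hs => IndicatorsMem.compl (hSD _ huniv) hs)
      (fun f hf _ h => IndicatorsMem.iUnion hD hempty h hf)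
  refine Submodule.eq_top_iff'.2 fun f => ?_
  refine Lp.induction (by simp) (fun f => f ∈ D) (fun c s hs hμs => ?_)
    (fun f g hf hg _ hfD hgD => D.add_mem hfD hgD) hD f
  obtain ⟨t, ht, hst⟩ := hgen s hs
  rw [Lp.simpleFunc.coe_indicatorConst]
  exact ((h0 t ht).congr hs hst).2 c

end IndicatorDense

/-! ### Residues generate the σ-algebra modulo null sets -/

namespace Desubstitutable

variable {A : Type u} [Finite A] [TopologicalSpace A] [DiscreteTopology A]
  [MeasurableSpace A] [BorelSpace A] {σ : ℕ → Substitution A} {q : ℕ → ℕ}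

theorem measurableSet_of_isClopen {s : Set (Shift σ)} (hs : IsClopen s) : MeasurableSet s :=
  hs.isOpen.measurableSet

/-- Let `B n` be the points missed at all levels below `n`. It depends only on the residue modulo
`q_0 ⋯ q_{n-1}`, so the shift by that product preserves it. At a coincidence level, `q_n` preimages
of `B n ∩ hitSet` under such shifts cover `B n`, so `μ(B n) ≤ q_n (μ(B n) - μ(B (n+1)))`. As `q_n`
is bounded and `μ(B n)` converges, the right side tends to `0` along these levels. -/
theorem measure_iInter_hitSet_compl (H : Desubstitutable σ q) (hfin : Finitary σ)
    (hcoin : {n | HasCoincidence (σ n)}.Infinite) {μ : Measure (Shift σ)} [IsProbabilityMeasure μ]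
    (hT : MeasurePreserving (shiftMap σ) μ μ) (j : ℤ) : μ (⋂ m, (H.hitSet m j)ᶜ) = 0 := by
  obtain ⟨y₀⟩ := nonempty_of_isProbabilityMeasure μ
  obtain ⟨Q, hQ⟩ : ∃ Q : ℕ, ∀ n, q n ≤ Q := by
    obtain ⟨S, hS, h⟩ := hfin
    obtain ⟨Q, hQ⟩ := (hS.image fun τ => (τ (y₀.1 0)).length).bddAbove
    exact ⟨Q, fun n => by rw [← H.constantLength n (y₀.1 0)]; exact hQ ⟨σ n, h n, rfl⟩⟩
  let B : ℕ → Set (Shift σ) := fun n => ⋂ m, ⋂ (_ : m < n), (H.hitSet m j)ᶜ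
  have hBm : ∀ n, MeasurableSet (B n) := fun n => MeasurableSet.iInter fun m =>
    MeasurableSet.iInter fun _ => (measurableSet_of_isClopen (H.isClopen_hitSet m j)).compl
  have hB : ∀ n y, y ∈ B n ↔ ∀ m < n, y ∉ H.hitSet m j := fun n y => by simp [B]
  have hBsucc : ∀ n, B (n + 1) = B n \ H.hitSet n j := fun n => by
    simp only [B, Set.biInter_lt_succ, Set.sdiff_eq]
  have hanti : Antitone B := antitone_nat_of_succ_le fun n => by
    rw [hBsucc]; exact Set.sdiff_subset
  have hinter : ⋂ n, B n = ⋂ m, (H.hitSet m j)ᶜ := by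
    ext y
    simp only [Set.mem_iInter, hB, Set.mem_compl_iff]
    exact ⟨fun h m => h (m + 1) m m.lt_succ_self, fun h n m _ => h m⟩
  have hlim : Tendsto (fun n => μ.real (B n)) atTop (𝓝 (μ.real (⋂ n, B n))) :=
    (ENNReal.tendsto_toReal (measure_ne_top _ _)).comp (tendsto_measure_iInter_atTop
      (fun n => (hBm n).nullMeasurableSet) hanti ⟨0, measure_ne_top _ _⟩)
  have hstep : ∀ n, HasCoincidence (σ n) →
      μ.real (B n) ≤ q n * (μ.real (B n) - μ.real (B (n + 1))) := by
    intro n hn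
    have hUm := measurableSet_of_isClopen (H.isClopen_hitSet n j)
    have hcover : B n ⊆ ⋃ t ∈ Finset.range (q n),
        (shiftMap σ)^[t * prodLen q n] ⁻¹' (B n ∩ H.hitSet n j) := by
      intro y hy
      obtain ⟨t, ht, hty⟩ := H.exists_lt_mem_hitSet hn y j
      refine Set.mem_iUnion₂.2 ⟨t, Finset.mem_range.2 ht, (hB _ _).2 fun m hm => ?_, hty⟩
      rw [← H.mem_hitSet_congr (y := y)]
      · exact (hB _ _).1 hy m hm
      · refine H.residue_eq_of_le hm ?_
        rw [residue_iterate, Nat.cast_mul, ZMod.natCast_self, mul_zero, add_zero]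
    have h1 : μ.real (B n) ≤ ∑ t ∈ Finset.range (q n), μ.real (B n ∩ H.hitSet n j) := by
      refine (measureReal_mono hcover (measure_ne_top μ _)).trans ((measureReal_biUnion_finset_le _ _).trans
        (Finset.sum_le_sum fun t _ => ?_))
      rw [measureReal_def, (hT.iterate _).measure_preimage
        ((hBm n).inter hUm).nullMeasurableSet, measureReal_def]
    have h2 := measureReal_inter_add_sdiff (μ := μ) (s := B n) hUm
    rw [Finset.sum_const, Finset.card_range, nsmul_eq_mul] at h1
    rw [hBsucc, ← h2, add_sub_cancel_right, h2]
    exact h1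
  have hmono : ∀ n, μ.real (⋂ n, B n) ≤ μ.real (B n) := fun n =>
    measureReal_mono (Set.iInter_subset _ n)
  have hdiff : Tendsto (fun n => (Q : ℝ) * (μ.real (B n) - μ.real (B (n + 1)))) atTop (𝓝 0) := by
    have := (hlim.sub (hlim.comp (tendsto_add_atTop_nat 1))).const_mul (Q : ℝ)
    simpa using this
  have hle : μ.real (⋂ n, B n) ≤ 0 := by
    refine ge_of_tendsto_of_frequently hdiff
      ((Nat.frequently_atTop_iff_infinite.2 hcoin).mono fun n hn => ?_)
    refine (hmono n).trans ((hstep n hn).trans (mul_le_mul_of_nonneg_right ?_ ?_))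
    · exact_mod_cast hQ n
    · exact sub_nonneg.2 (measureReal_mono (hanti n.le_succ))
  rw [← hinter]
  exact (measureReal_eq_zero_iff).1 (le_antisymm hle measureReal_nonneg)

/-- Preimages of sets of residues form a π-system whose indicators are combinations of
eigenfunctions. Almost every `y` has coordinate `j` determined by a residue, so the π-system
generates the σ-algebra modulo null sets. -/
theorem hasDiscreteSpectrum (H : Desubstitutable σ q) (hfin : Finitary σ)
    (hcoin : {n | HasCoincidence (σ n)}.Infinite) {μ : Measure (Shift σ)} [IsProbabilityMeasure μ]
    (hT : MeasurePreserving (shiftMap σ) μ μ) : HasDiscreteSpectrum hT := by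
  let S : Set (Set (Shift σ)) := {s | ∃ n C, s = H.residue n ⁻¹' C}
  have hSc : ∀ n C, IsClopen (H.residue n ⁻¹' C) := fun n C =>
    (isClopen_discrete C).preimage (H.continuous_residue n)
  refine eq_top_of_indicatorsMem (S := S) (Submodule.isClosed_topologicalClosure _) ?_ ?_
    ⟨0, Set.univ, rfl⟩ ?_
  · rintro _ ⟨m, C, rfl⟩ _ ⟨n, C', rfl⟩ -
    refine ⟨max m n, H.residue (max m n) '' (H.residue m ⁻¹' C ∩ H.residue n ⁻¹' C'), ?_⟩
    refine (Set.subset_preimage_image _ _).antisymm ?_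
    rintro y ⟨y', ⟨h1, h2⟩, h⟩
    constructor
    · rw [Set.mem_preimage, ← H.residue_eq_of_le (le_max_left m n) h]
      exact h1
    · rw [Set.mem_preimage, ← H.residue_eq_of_le (le_max_right m n) h]
      exact h2
  · rintro _ ⟨n, C, rfl⟩
    have hm : MeasurableSet (H.residue n ⁻¹' C) := measurableSet_of_isClopen (hSc n C)
    refine ⟨hm, fun c => Submodule.le_topologicalClosure _ ?_⟩
    let _ : MeasurableSpace (ZMod (prodLen q n)) := ⊤
    have : NeZero (prodLen q n) := ⟨(prodLen_pos H.two_le n).ne'⟩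
    exact toLp_comp_mem_iSup_eigenspace hT
      (fun C _ => measurableSet_of_isClopen (hSc n C)) (H.residue_shiftMap n)
      (C.indicator fun _ => c)
  · have key : ∀ j : ℤ, Measurable[eventuallyMeasurableSpace (MeasurableSpace.generateFrom S)
        (ae μ)] fun y : Shift σ => y.1 j := by
      intro j s _
      -- Saturating by residues adds nothing wrong: a point sharing its residue with a point of the
      -- hit set has the same letter at `j`.
      refine ⟨⋃ m, H.residue (m + 1) ⁻¹' (H.residue (m + 1) '' ({y | y.1 j ∈ s} ∩ H.hitSet m j)),
        MeasurableSet.iUnion fun m => MeasurableSpace.measurableSet_generateFrom ⟨_, _, rfl⟩, ?_⟩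
      have hae : ∀ᵐ y ∂μ, y ∉ ⋂ m, (H.hitSet m j)ᶜ :=
        measure_eq_zero_iff_ae_notMem.1 (H.measure_iInter_hitSet_compl hfin hcoin hT j)
      filter_upwards [hae] with y hy
      refine propext ⟨fun h => ?_, fun h => ?_⟩
      · obtain ⟨m, hm⟩ : ∃ m, y ∈ H.hitSet m j := by simpa using hy
        exact Set.mem_iUnion.2 ⟨m, y, ⟨h, hm⟩, rfl⟩
      · obtain ⟨m, y', ⟨h1, h2⟩, h3⟩ := Set.mem_iUnion.1 h
        have : y'.1 j = y.1 j := H.eq_of_mem_hitSet h2 h3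
        change y.1 j ∈ s
        rw [← this]
        exact h1
    exact measurable_iff_comap_le.1
      (@measurable_pi_iff _ _ _ (eventuallyMeasurableSpace _ _) _ _ |>.2 key)

end Desubstitutable

end SAdic

theorem mainTheorem8 {A : Type u} [Finite A] [TopologicalSpace A] [DiscreteTopology A]
    [MeasurableSpace A] [BorelSpace A]
    (σ : ℕ → SAdic.Substitution A) (q : ℕ → ℕ)
    (hfin : SAdic.Finitary σ) (hprim : SAdic.Primitive σ)
    (hlen : SAdic.ConstantLength σ q) (hq : ∀ n, 2 ≤ q n)
    (hess : ∃ a b : A, SAdic.FullyEssential σ [a, b])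
    (hcoin : {n | SAdic.HasCoincidence (σ n)}.Infinite)
    (hrec : (SAdic.PrefixStraight σ ∧ SAdic.OneSidedRecognizable σ) ∨
      (SAdic.Straight σ ∧ SAdic.Recognizable σ)) :
    SAdic.IsToeplitz (SAdic.shiftMap σ) ∧
    (∀ μ : Measure (SAdic.Shift σ), IsProbabilityMeasure μ →
      ∀ hT : MeasurePreserving (SAdic.shiftMap σ) μ μ, SAdic.HasDiscreteSpectrum hT) ∧
    0 < SAdic.height (SAdic.shiftMap σ) q ∧
    SAdic.IsMaximalEquicontinuousFactor.{u, 0, v} (SAdic.shiftMap σ)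
      (SAdic.Odometer.addOne
        (SAdic.consSeq (SAdic.height (SAdic.shiftMap σ) q) q)) := by
  have H : SAdic.Desubstitutable σ q := ⟨hlen, hq, hrec.elim
    (fun h => h.2.uniqueDesubstitution hlen hq) (fun h => h.2.uniqueDesubstitution hlen)⟩
  have hne : Nonempty (SAdic.Shift σ) := by
    obtain ⟨a, b, -, h⟩ := hess
    obtain ⟨x, hx, -⟩ := h 0
    exact ⟨⟨x, hx⟩⟩
  -- With height `1` the target is the odometer of `(1, q_0, q_1, …)`; the leading `1` only delays
  -- the partial products by one index.
  have hr : ∀ n, SAdic.prodLen (SAdic.consSeq 1 q) (n + 1) = SAdic.prodLen q n := fun n => by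
    rw [SAdic.prodLen, Finset.prod_range_succ', SAdic.consSeq, mul_one]
    rfl
  refine ⟨H.isToeplitz hprim hcoin, fun μ _ hT => H.hasDiscreteSpectrum hfin hcoin hT, ?_, ?_⟩
  · rw [H.height_eq_one hcoin]
    exact one_pos
  · rw [H.height_eq_one hcoin]
    refine H.isMaximalEquicontinuousFactor hcoin (fun n => ?_) fun n => ⟨n + 1, (hr n).symm.dvd⟩
    cases n with
    | zero => simp [SAdic.prodLen]
    | succ n => rw [hr]; exact SAdic.prodLen_dvd q n.le_succ
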